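/- Let $E$ be a real Banach lattice with positive cone $E_+$ and dual space $E'$. A \emph{$C_0$-semigroup} on $E$ is a map $S$ from $(0,\infty)$ into the bounded linear operators on $E$ with $S(s+t)=S(t)S(s)$ for all $s,t>0$, with $\sup_{0<t\le 1}\|S(t)\|<\infty$, and with $S(t)f\to f$ as $t\downarrow 0$ for each $f\in E$. Its generator $A$ is given by $Af=\lim_{t\downarrow 0}\frac{S(t)f-f}{t}$ on the domain of all $f\in E$ for which this limit exists, and $A'$ denotes the dual operator of $A$ on $E'$. The semigroup is \emph{positive} if $S(t)f\ge 0$ for all $t>0$ and $f\ge 0$; \emph{bounded} if $\sup_{t>0}\|S(t)\|<\infty$; \emph{irreducible} if for all $0\ne f\in E_+$ and all non-zero positive functionals $\varphi\in E'$ there is $t>0$ with $\langle\varphi,S(t)f\rangle>0$; and \emph{eventually norm continuous} if there is $t_0\ge 0$ such that $t\mapsto S(t)$ is continuous on $(t_0,\infty)$ with respect to the operator norm. A vector $u\in E_+$ is \emph{quasi-interior} if $\lim_{n\to\infty} v\wedge(nu)=v$ for all $v\in E_+$; a functional $\varphi\in E'$ is \emph{strictly positive} if $\langle\varphi,f\rangle>0$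 for all $0\neq f\in E_+$. We say that $S(t)$ \emph{converges strongly} as $t\to\infty$ if $\lim_{t\to\infty}S(t)f$ exists in the norm of $E$ for every $f\in E$. Theorem. Let $S$ be a positive, bounded, irreducible and eventually norm continuous $C_0$-semigroup on $E$ with generator $A$. Then precisely one of the following four situations occurs: (i) $\dim(\ker A')=0$. In this case, $S(t)f\to 0$ as $t\to\infty$ for each $f\in E$. (ii) $\dim(\ker A')=1$ and $\dim(\ker A)=1$. In this case, there exist a quasi-interior point $u\in E_+$ and a strictly positive functional $\varphi\in E'$ such that $S(t)f\to\langle\varphi,f\rangle u$ as $t\to\infty$ for each $f\in E$. (iii) $\dim(\ker A')=1$ and $\dim(\ker A)=0$. In this case, $S(t)$ does not converge strongly as $t\to\infty$. (iv) $\dim(\ker A')\ge 2$. In this case, $S(t)$ does not converge strongly as $t\to\infty$. -/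

import Mathlib

open Filter Topology Set

noncomputable section

namespace BanachLatticeSemigroup

variable {E : Type*} [NormedAddCommGroup E] [NormedSpace ℝ E]

/-! A semigroup is a map on the open half line `(0, ∞)`. It is represented by a function
`S : ℝ → E →L[ℝ] E`, and every notion below uses only its values `S t` with `0 < t`. -/

/-- A one-parameter operator semigroup on `E`: the semigroup law on `(0, ∞)`, together with local
boundedness at `0`. -/
structure IsSemigroup (S : ℝ → E →L[ℝ] E) : Prop where
  add : ∀ s t : ℝ, 0 < s → 0 < t → S (s + t) = (S t).comp (S s)
  locallyBounded : ∃ M : ℝ, ∀ t : ℝ, 0 < t → t ≤ 1 → ‖S t‖ ≤ M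

/-- A `C₀`-semigroup: `S(t) f → f` as `t ↓ 0` for each `f`. -/
structure IsC0Semigroup (S : ℝ → E →L[ℝ] E) : Prop extends IsSemigroup S where
  tendsto_zero : ∀ f : E, Tendsto (fun t => S t f) (𝓝[>] 0) (𝓝 f)

/-- Boundedness: `sup_{t > 0} ‖S(t)‖ < ∞`. -/
def IsBoundedSemigroup (S : ℝ → E →L[ℝ] E) : Prop :=
  ∃ M : ℝ, ∀ t : ℝ, 0 < t → ‖S t‖ ≤ M

/-- Eventual norm continuity: for some `t₀ ≥ 0` the map `(t₀, ∞) ∋ t ↦ S(t)` is continuous with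
respect to the operator norm. -/
def IsEventuallyNormContinuous (S : ℝ → E →L[ℝ] E) : Prop :=
  ∃ t₀ : ℝ, 0 ≤ t₀ ∧ ContinuousOn S (Ioi t₀)

/-- Strong convergence of `S(t)` as `t → ∞`: every orbit has a limit in norm. -/
def ConvergesStrongly (S : ℝ → E →L[ℝ] E) : Prop :=
  ∀ f : E, ∃ g : E, Tendsto (fun t => S t f) atTop (𝓝 g)

/-- The domain of the generator: all `f` for which `lim_{t ↓ 0} (S(t) f - f) / t` exists. -/
def generatorDomain (S : ℝ → E →L[ℝ] E) : Submodule ℝ E where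
  carrier := {f | ∃ g : E, Tendsto (fun t : ℝ => t⁻¹ • (S t f - f)) (𝓝[>] 0) (𝓝 g)}
  zero_mem' := ⟨0, by simp⟩
  add_mem' := by
    rintro f₁ f₂ ⟨g₁, h₁⟩ ⟨g₂, h₂⟩
    refine ⟨g₁ + g₂, (h₁.add h₂).congr fun t => ?_⟩
    rw [map_add, ← smul_add]
    congr 1
    abel
  smul_mem' := by
    rintro c f ⟨g, h⟩
    refine ⟨c • g, (h.const_smul c).congr fun t => ?_⟩
    rw [map_smul, ← smul_sub, smul_comm]

/-- The generator `A` of `S`, an unbounded operator on `E`: `A f = lim_{t ↓ 0} (S(t) f - f) / t` on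
the domain `generatorDomain S`. -/
def generator (S : ℝ → E →L[ℝ] E) : E →ₗ.[ℝ] E where
  domain := generatorDomain S
  toFun :=
    { toFun := fun f => Classical.choose f.2
      map_add' := by
        intro f₁ f₂
        refine tendsto_nhds_unique (Classical.choose_spec (f₁ + f₂).2)
          (((Classical.choose_spec f₁.2).add (Classical.choose_spec f₂.2)).congr fun t => ?_)
        rw [Submodule.coe_add, map_add, ← smul_add]
        congr 1
        abel
      map_smul' := by
        intro c f
        refine tendsto_nhds_unique (Classical.choose_spec (c • f).2)
          (((Classical.choose_spec f.2).const_smul c).congr fun t => ?_)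
        rw [Submodule.coe_smul, map_smul, ← smul_sub, smul_comm] }

theorem generator_tendsto (S : ℝ → E →L[ℝ] E) (f : (generator S).domain) :
    Tendsto (fun t : ℝ => t⁻¹ • (S t f - f)) (𝓝[>] 0) (𝓝 (generator S f)) :=
  Classical.choose_spec f.2

/-- The graph of the dual operator `A'`: all pairs `(φ, ψ)` of continuous linear functionals with
`⟨ψ, f⟩ = ⟨φ, A f⟩` for all `f` in the domain of `A`. -/
def dualGraph (A : E →ₗ.[ℝ] E) : Submodule ℝ (StrongDual ℝ E × StrongDual ℝ E) where
  carrier := {p | ∀ f : A.domain, p.2 (f : E) = p.1 (A f)}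
  zero_mem' := by intro f; simp
  add_mem' := by
    intro p q hp hq f
    simp [hp f, hq f]
  smul_mem' := by
    intro c p hp f
    simp [hp f]

/-- The dual operator `A'` of a densely defined operator `A`, an unbounded operator on `E'`. (As in
Mathlib's `LinearPMap.adjoint`, the values are junk if `A` is not densely defined; generators
of `C₀`-semigroups are densely defined.) -/
def dualOperator (A : E →ₗ.[ℝ] E) : StrongDual ℝ E →ₗ.[ℝ] StrongDual ℝ E :=
  (dualGraph A).toLinearPMap

theorem graph_dualOperator (A : E →ₗ.[ℝ] E) (hA : Dense (A.domain : Set E)) :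
    (dualOperator A).graph = dualGraph A := by
  refine Submodule.toLinearPMap_graph_eq _ ?_
  rintro ⟨φ, ψ⟩ h h0
  have h0' : φ = 0 := h0
  subst h0'
  have h1 : ∀ f : A.domain, ψ (f : E) = 0 := fun f => by simpa using h f
  refine ContinuousLinearMap.coeFn_injective (Continuous.ext_on hA ψ.continuous
    (0 : StrongDual ℝ E).continuous ?_)
  intro f hf
  simpa using h1 ⟨f, hf⟩

/-- The dimension of the kernel of an unbounded operator, as a cardinal. -/
def kerDim {V : Type*} [AddCommGroup V] [Module ℝ V] (A : V →ₗ.[ℝ] V) : Cardinal :=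
  Module.rank ℝ (LinearMap.ker A.toFun)

section Order

variable [Lattice E]

/-- Positivity of a semigroup: `S(t) f ≥ 0` whenever `f ≥ 0` and `t > 0`. -/
def IsPositiveSemigroup (S : ℝ → E →L[ℝ] E) : Prop :=
  ∀ t : ℝ, 0 < t → ∀ f : E, 0 ≤ f → 0 ≤ S t f

/-- Positivity of a functional: `⟨φ, f⟩ ≥ 0` for all `f ≥ 0`. -/
def IsPositiveFunctional (φ : StrongDual ℝ E) : Prop :=
  ∀ f : E, 0 ≤ f → 0 ≤ φ f

/-- Strict positivity of a functional: `⟨φ, f⟩ > 0` whenever `f ≥ 0` and `f ≠ 0`. -/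
def IsStrictlyPositiveFunctional (φ : StrongDual ℝ E) : Prop :=
  ∀ f : E, 0 < f → 0 < φ f

/-- Irreducibility of a positive semigroup: for all `0 < f` in `E` and `0 < φ` in `E'` there is a
time `t > 0` with `⟨φ, S(t) f⟩ > 0`. -/
def IsIrreducibleSemigroup (S : ℝ → E →L[ℝ] E) : Prop :=
  ∀ f : E, 0 < f → ∀ φ : StrongDual ℝ E, IsPositiveFunctional φ → φ ≠ 0 →
    ∃ t : ℝ, 0 < t ∧ 0 < φ (S t f)

/-- A quasi-interior point of the positive cone: `u ≥ 0` and `v ∧ (n u) → v` as `n → ∞` for each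
`v ≥ 0`. -/
def IsQuasiInterior (u : E) : Prop :=
  0 ≤ u ∧ ∀ v : E, 0 ≤ v → Tendsto (fun n : ℕ => v ⊓ (n • u)) atTop (𝓝 v)

end Order

end BanachLatticeSemigroup

end

open BanachLatticeSemigroup

/-! The analytic core is `tendsto_increment`: positivity, boundedness and eventual norm continuity
force `S t (S a f - f)` to tend to zero for all `f` and all `a > 0`. A functional that vanishes on
the vectors with vanishing orbits is therefore fixed by the dual semigroup, so by Hahn-Banach an
orbit tends to zero once every fixed functional kills its starting point
(`tendsto_zero_of_forall_fixedFunctional`).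

For the core, put `R = S s` with small `s`. Consider bounded sequences `w` with `R (w j)` equal to
`w (j + 1)` up to errors whose transported sum grows at an arbitrarily small linear rate. Since `R`
is positive with bounded powers, the losses `R |w j| - |R (w j)|` telescope, so these sequences form
a vector lattice (`IsCoherent.abs`). Norm continuity makes some `R ^ (m + 1) - R ^ m` of norm at
most `ω`, which bounds the increments of every such sequence by a multiple of `ω` times its size.
Apply this to triangular waves of an orbit whose period is `8 * s` times a slowly varying weight.
Their size is of order `s`, yet at each step one of two phases reproduces the increment of the
orbit, up to small errors. That increment is thus of order `ω * s`, and over the `a / s` steps that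
fill time `a` it is of order `a * ω`, which is arbitrarily small (`orbit_increment_bound`).

The rest is order theory. The kernels of the generator and of its dual are the fixed vectors and the
fixed functionals. A nonzero fixed functional yields a positive one, which irreducibility makes
strictly positive; then the fixed vectors form a sublattice of dimension at most one, spanned by a
quasi-interior point if nonzero. Under strong convergence every limit is a fixed vector on which
fixed functionals keep their values, so a nonzero space of fixed functionals requires a nonzero
fixed vector, and it is then one-dimensional. -/

set_option linter.unusedSectionVars false

/-! ### Real-valued lattice homomorphisms on principal ideals. -/

section RealPoints

variable {E : Type*} [NormedAddCommGroup E] [NormedSpace ℝ E] [Lattice E] [IsOrderedAddMonoid E]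
  [IsOrderedModule ℝ E]

/-- `v` lies in the principal ideal generated by `e`. -/
def InIdeal (e v : E) : Prop := ∃ C : ℝ, 0 ≤ C ∧ v ≤ C • e ∧ -v ≤ C • e

theorem InIdeal.self {e : E} (he : 0 ≤ e) : InIdeal e e :=
  ⟨1, zero_le_one, by simp, by simpa using neg_le_self he⟩

theorem InIdeal.neg {e v : E} (h : InIdeal e v) : InIdeal e (-v) := by
  obtain ⟨C, h0, h1, h2⟩ := h
  exact ⟨C, h0, h2, by simpa using h1⟩

theorem InIdeal.add {e v w : E} (h : InIdeal e v) (h' : InIdeal e w) : InIdeal e (v + w) := by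
  obtain ⟨C, h0, h1, h2⟩ := h
  obtain ⟨D, k0, k1, k2⟩ := h'
  refine ⟨C + D, by positivity, ?_, ?_⟩
  · rw [add_smul]; exact add_le_add h1 k1
  · rw [add_smul, neg_add]; exact add_le_add h2 k2

theorem InIdeal.sub {e v w : E} (h : InIdeal e v) (h' : InIdeal e w) : InIdeal e (v - w) := by
  rw [sub_eq_add_neg]; exact h.add h'.neg

theorem InIdeal.smul {e v : E} (h : InIdeal e v) (c : ℝ) : InIdeal e (c • v) := by
  have key : ∀ {c : ℝ}, 0 ≤ c → InIdeal e (c • v) := by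
    intro c hc
    obtain ⟨C, h0, h1, h2⟩ := h
    refine ⟨c * C, by positivity, ?_, ?_⟩
    · rw [mul_smul]; exact smul_le_smul_of_nonneg_left h1 hc
    · rw [mul_smul, ← smul_neg]; exact smul_le_smul_of_nonneg_left h2 hc
  rcases le_total 0 c with hc | hc
  · exact key hc
  · have := (key (neg_nonneg.2 hc)).neg
    rwa [neg_smul, neg_neg] at this

theorem InIdeal.inf {e v w : E} (he : 0 ≤ e) (h : InIdeal e v) (h' : InIdeal e w) :
    InIdeal e (v ⊓ w) := by
  obtain ⟨C, h0, h1, h2⟩ := h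
  obtain ⟨D, k0, k1, k2⟩ := h'
  have hC : C • e ≤ (C + D) • e := smul_le_smul_of_nonneg_right (by linarith) he
  have hD : D • e ≤ (C + D) • e := smul_le_smul_of_nonneg_right (by linarith) he
  refine ⟨C + D, by positivity, inf_le_left.trans (h1.trans hC), ?_⟩
  rw [neg_inf]
  exact sup_le (h2.trans hC) (k2.trans hD)

theorem InIdeal.abs {e v : E} (he : 0 ≤ e) (h : InIdeal e v) : InIdeal e |v| := by
  have := (h.inf he h.neg).neg
  rwa [neg_inf, neg_neg, sup_comm] at this

theorem InIdeal.of_abs_le {e v w : E} (hw : InIdeal e w) (h : |v| ≤ w) : InIdeal e v := by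
  obtain ⟨C, h0, h1, -⟩ := hw
  exact ⟨C, h0, (le_abs_self v).trans (h.trans h1), (neg_le_abs v).trans (h.trans h1)⟩

/-- A real-valued lattice homomorphism on the principal ideal generated by `e`, normalized at `e`. -/
structure IsRealPoint (e : E) (χ : E → ℝ) : Prop where
  nonneg : 0 ≤ e
  unit : χ e = 1
  add : ∀ {v w : E}, InIdeal e v → InIdeal e w → χ (v + w) = χ v + χ w
  smul : ∀ {v : E} (c : ℝ), InIdeal e v → χ (c • v) = c * χ v
  inf : ∀ {v w : E}, InIdeal e v → InIdeal e w → χ (v ⊓ w) = min (χ v) (χ w)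

theorem IsRealPoint.neg {e : E} {χ : E → ℝ} (h : IsRealPoint e χ) {v : E} (hv : InIdeal e v) :
    χ (-v) = -χ v := by
  have := h.smul (-1) hv
  simpa using this

theorem IsRealPoint.sub {e : E} {χ : E → ℝ} (h : IsRealPoint e χ) {v w : E} (hv : InIdeal e v)
    (hw : InIdeal e w) : χ (v - w) = χ v - χ w := by
  rw [sub_eq_add_neg, h.add hv hw.neg, h.neg hw, sub_eq_add_neg]

theorem IsRealPoint.abs {e : E} {χ : E → ℝ} (h : IsRealPoint e χ) {v : E}
    (hv : InIdeal e v) : χ |v| = |χ v| := by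
  have h1 : |v| = - (v ⊓ -v) := by rw [neg_inf, neg_neg, sup_comm]; rfl
  rw [h1, h.neg (hv.inf h.nonneg hv.neg), h.inf hv hv.neg, h.neg hv, abs_eq_max_neg,
    ← max_neg_neg, neg_neg, max_comm]

theorem IsRealPoint.mono {e : E} {χ : E → ℝ} (h : IsRealPoint e χ) {v w : E} (hv : InIdeal e v)
    (hw : InIdeal e w) (hvw : v ≤ w) : χ v ≤ χ w := by
  have := h.inf hv hw
  rw [inf_eq_left.2 hvw] at this
  rw [this]; exact min_le_right _ _

/-- A cone that contains the positive cone and is closed under finite infima. -/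
structure IsLatticeCone (Q : Set E) : Prop where
  of_nonneg : ∀ {v : E}, 0 ≤ v → v ∈ Q
  add : ∀ {v w : E}, v ∈ Q → w ∈ Q → v + w ∈ Q
  inf : ∀ {v w : E}, v ∈ Q → w ∈ Q → v ⊓ w ∈ Q
  smul : ∀ {v : E} {c : ℝ}, 0 ≤ c → v ∈ Q → c • v ∈ Q

theorem IsLatticeCone.mono {Q : Set E} (h : IsLatticeCone Q) {v w : E} (hv : v ∈ Q) (hvw : v ≤ w) :
    w ∈ Q := by
  have := h.add hv (h.of_nonneg (sub_nonneg.2 hvw))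
  rwa [add_sub_cancel] at this

/-- The lattice cone generated by a lattice cone `Q` and one further element `p`. -/
theorem IsLatticeCone.adjoin {Q : Set E} (h : IsLatticeCone Q) (p : E) :
    IsLatticeCone {z : E | ∃ q ∈ Q, ∃ c : ℝ, 0 ≤ c ∧ q - c • p⁻ ≤ z} where
  of_nonneg := fun {v} hv => ⟨v, h.of_nonneg hv, 0, le_rfl, by simp⟩
  add := by
    rintro v w ⟨q, hq, c, hc, hv⟩ ⟨r, hr, d, hd, hw⟩
    refine ⟨q + r, h.add hq hr, c + d, by positivity, ?_⟩
    have := add_le_add hv hw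
    rw [add_smul]
    convert this using 1
    abel
  inf := by
    rintro v w ⟨q, hq, c, hc, hv⟩ ⟨r, hr, d, hd, hw⟩
    refine ⟨q ⊓ r, h.inf hq hr, max c d, hc.trans (le_max_left _ _), le_inf ?_ ?_⟩
    · exact (sub_le_sub inf_le_left
        (smul_le_smul_of_nonneg_right (le_max_left _ _) (negPart_nonneg p))).trans hv
    · exact (sub_le_sub inf_le_right
        (smul_le_smul_of_nonneg_right (le_max_right _ _) (negPart_nonneg p))).trans hw
  smul := by
    rintro v a ha ⟨q, hq, c, hc, hv⟩
    refine ⟨a • q, h.smul ha hq, a * c, by positivity, ?_⟩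
    rw [mul_smul, ← smul_sub]
    exact smul_le_smul_of_nonneg_left hv ha

/-- A lattice cone that is maximal among those avoiding `-k` is total. -/
theorem exists_total_latticeCone {k : E} (hk : ¬ k ≤ 0) :
    ∃ Q : Set E, IsLatticeCone Q ∧ -k⁺ ∉ Q ∧ ∀ v : E, v ∈ Q ∨ -v ∈ Q := by
  have hk0 : -k⁺ ∉ {v : E | 0 ≤ v} := by
    intro h
    have h1 : k⁺ ≤ 0 := by simpa using h
    exact hk ((le_posPart k).trans h1)
  obtain ⟨Q, -, ⟨hQ, hQk⟩, hmax⟩ := zorn_subset_nonempty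
    {Q : Set E | IsLatticeCone Q ∧ -k⁺ ∉ Q} (by
      intro c hc hchain hne
      refine ⟨⋃₀ c, ⟨⟨?_, ?_, ?_, ?_⟩, ?_⟩, fun s hs => subset_sUnion_of_mem hs⟩
      · intro v hv
        obtain ⟨s, hs⟩ := hne
        exact ⟨s, hs, (hc hs).1.of_nonneg hv⟩
      · rintro v w ⟨s, hs, hv⟩ ⟨t, ht, hw⟩
        rcases hchain.total hs ht with hst | hst
        · exact ⟨t, ht, (hc ht).1.add (hst hv) hw⟩
        · exact ⟨s, hs, (hc hs).1.add hv (hst hw)⟩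
      · rintro v w ⟨s, hs, hv⟩ ⟨t, ht, hw⟩
        rcases hchain.total hs ht with hst | hst
        · exact ⟨t, ht, (hc ht).1.inf (hst hv) hw⟩
        · exact ⟨s, hs, (hc hs).1.inf hv (hst hw)⟩
      · rintro v a ha ⟨s, hs, hv⟩
        exact ⟨s, hs, (hc hs).1.smul ha hv⟩
      · rintro ⟨s, hs, hv⟩
        exact (hc hs).2 hv) {v : E | 0 ≤ v}
    ⟨⟨fun h => h, fun h h' => add_nonneg h h', fun h h' => le_inf h h',
      fun hc h => smul_nonneg hc h⟩, hk0⟩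
  refine ⟨Q, hQ, hQk, ?_⟩
  have key : ∀ p : E, p ∉ Q → ∃ q ∈ Q, ∃ c : ℝ, 0 ≤ c ∧ q - c • p⁻ ≤ -k⁺ := by
    intro p hp
    by_contra hcon
    have hmem := hmax (y := {z : E | ∃ q ∈ Q, ∃ c : ℝ, 0 ≤ c ∧ q - c • p⁻ ≤ z})
      ⟨hQ.adjoin p, hcon⟩ (fun q hq => ⟨q, hq, 0, le_rfl, by simp⟩)
    -- The adjoined cone contains `p` because `-p⁻ ≤ p`; by maximality `p` would already lie in `Q`.
    refine hp (hmem ⟨0, hQ.of_nonneg le_rfl, 1, zero_le_one, ?_⟩)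
    rw [one_smul, zero_sub]
    exact neg_le.1 (neg_le_negPart p)
  intro p
  by_contra hcon
  rw [not_or] at hcon
  obtain ⟨q, hq, c, hc, h1⟩ := key p hcon.1
  obtain ⟨r, hr, d, hd, h2⟩ := key (-p) hcon.2
  rw [negPart_neg] at h2
  apply hQk
  refine hQ.mono (hQ.inf hq hr) ?_
  -- Disjointness of `p⁺` and `p⁻` makes the two witnesses clash: `q ⊓ r + k⁺` lies below both
  -- multiples, hence below `0`, which would put `-k⁺` into `Q`.
  have h3 : (c + d) • p⁻ ⊓ (c + d) • p⁺ = 0 := by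
    have hcd : 0 ≤ c + d := by positivity
    have hb : p⁻ ⊓ p⁺ = 0 := by rw [inf_comm]; exact posPart_inf_negPart_eq_zero p
    refine le_antisymm ?_ (le_inf (smul_nonneg hcd (negPart_nonneg p))
      (smul_nonneg hcd (posPart_nonneg p)))
    rcases hcd.eq_or_lt with h0 | h0
    · rw [← h0]; simp
    · have h4 : (c + d)⁻¹ • ((c + d) • p⁻ ⊓ (c + d) • p⁺) ≤ p⁻ ⊓ p⁺ := by
        refine le_inf ?_ ?_
        · refine (smul_le_smul_of_nonneg_left inf_le_left (by positivity)).trans ?_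
          rw [smul_smul, inv_mul_cancel₀ h0.ne', one_smul]
        · refine (smul_le_smul_of_nonneg_left inf_le_right (by positivity)).trans ?_
          rw [smul_smul, inv_mul_cancel₀ h0.ne', one_smul]
      rw [hb] at h4
      have h5 := smul_le_smul_of_nonneg_left h4 hcd
      rwa [smul_smul, mul_inv_cancel₀ h0.ne', one_smul, smul_zero] at h5
  have h5 : q ⊓ r + k⁺ ≤ (c + d) • p⁻ := by
    have : q + k⁺ ≤ c • p⁻ := by
      have := add_le_add_left h1 (c • p⁻ + k⁺)
      simpa [sub_add_eq_add_sub, add_comm, add_left_comm, add_assoc] using this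
    exact (add_le_add_left inf_le_left _).trans (this.trans
      (smul_le_smul_of_nonneg_right (by linarith) (negPart_nonneg p)))
  have h6 : q ⊓ r + k⁺ ≤ (c + d) • p⁺ := by
    have : r + k⁺ ≤ d • p⁺ := by
      have := add_le_add_left h2 (d • p⁺ + k⁺)
      simpa [sub_add_eq_add_sub, add_comm, add_left_comm, add_assoc] using this
    exact (add_le_add_left inf_le_right _).trans (this.trans
      (smul_le_smul_of_nonneg_right (by linarith) (posPart_nonneg p)))
  have h7 := le_inf h5 h6
  rw [h3] at h7
  exact le_neg_iff_add_nonpos_right.2 h7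

/-- Real-valued lattice homomorphisms on a principal ideal detect positivity. -/
theorem exists_realPoint {e k : E} (he : 0 ≤ e) (hke : InIdeal e k) (hk : ¬ k ≤ 0) :
    ∃ χ : E → ℝ, IsRealPoint e χ ∧ 0 ≤ χ k := by
  obtain ⟨Q, hQ, hQk, htot⟩ := exists_total_latticeCone hk
  -- Otherwise scaling puts `-(C • e)` into `Q`, and with it the larger element `-k⁺`.
  have hneg : ∀ c : ℝ, 0 < c → -(c • e) ∉ Q := by
    intro c hc hmem
    obtain ⟨C, hC0, hC, -⟩ := hke
    apply hQk
    have h1 := hQ.smul (c := C / c) (by positivity) hmem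
    rw [smul_neg, smul_smul, div_mul_cancel₀ _ hc.ne'] at h1
    refine hQ.mono h1 (neg_le_neg ?_)
    rw [posPart_def]
    exact sup_le hC (smul_nonneg hC0 he)
  have hkQ : k ∈ Q := by
    rcases htot k with h | h
    · exact h
    · exfalso
      apply hQk
      have := hQ.inf h (hQ.of_nonneg le_rfl)
      rwa [posPart_def, neg_sup, neg_zero]
  -- As `Q` is total, `χ v` is the cut that `v` makes among the multiples of `e`. Below, `ha` and
  -- `hb` turn strict inequalities into membership in `Q`, and `hle` and `hge` go back.
  let χ : E → ℝ := fun v => sSup {r : ℝ | v - r • e ∈ Q}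
  have hcmp : ∀ {v : E} {r r' : ℝ}, v - r • e ∈ Q → r' • e - v ∈ Q → r ≤ r' := by
    intro v r r' h h'
    by_contra hlt
    push Not at hlt
    apply hneg (r - r') (by linarith)
    have := hQ.add h h'
    convert this using 1
    rw [sub_smul]; abel
  have hbdd : ∀ {v : E}, InIdeal e v → BddAbove {r : ℝ | v - r • e ∈ Q} := by
    rintro v ⟨C, -, h1, -⟩
    exact ⟨C, fun r hr => hcmp hr (hQ.of_nonneg (sub_nonneg.2 h1))⟩
  have hne : ∀ {v : E}, InIdeal e v → {r : ℝ | v - r • e ∈ Q}.Nonempty := by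
    rintro v ⟨C, -, -, h2⟩
    refine ⟨-C, hQ.of_nonneg ?_⟩
    rw [neg_smul, sub_neg_eq_add]
    exact neg_le_iff_add_nonneg'.1 h2
  have ha : ∀ {v : E} {r : ℝ}, InIdeal e v → r < χ v → v - r • e ∈ Q := by
    intro v r hv hr
    obtain ⟨r', h1, h2⟩ := exists_lt_of_lt_csSup (hne hv) hr
    refine hQ.mono h1 (sub_le_sub_left ?_ _)
    exact smul_le_smul_of_nonneg_right h2.le he
  have hle : ∀ {v : E} {r : ℝ}, InIdeal e v → v - r • e ∈ Q → r ≤ χ v :=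
    fun hv hr => le_csSup (hbdd hv) hr
  have hb : ∀ {v : E} {r : ℝ}, InIdeal e v → χ v < r → r • e - v ∈ Q := by
    intro v r hv hr
    rcases htot (r • e - v) with h | h
    · exact h
    · rw [neg_sub] at h
      exact absurd (hle hv h) (not_le.2 hr)
  have hge : ∀ {v : E} {r : ℝ}, InIdeal e v → r • e - v ∈ Q → χ v ≤ r :=
    fun hv hr => csSup_le (hne hv) fun r' h' => hcmp h' hr
  have hneg' : ∀ {v : E}, InIdeal e v → χ (-v) = -χ v := by
    intro v hv
    apply le_antisymm
    · refine le_of_forall_pos_le_add fun ε hε => hge hv.neg ?_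
      have := ha hv (show χ v - ε < χ v by linarith)
      convert this using 1
      module
    · refine le_of_forall_pos_le_add fun ε hε => ?_
      have := hb hv (show χ v < χ v + ε by linarith)
      have h2 := hle (r := -(χ v + ε)) hv.neg (by convert this using 1; module)
      linarith
  have hpos : ∀ {v : E} {c : ℝ}, InIdeal e v → 0 < c → c * χ v ≤ χ (c • v) := by
    intro v c hv hc
    refine le_of_forall_pos_le_add fun ε hε => ?_
    have h1 := hQ.smul hc.le (ha hv (show χ v - ε / c < χ v by have := div_pos hε hc; linarith))
    have h2 := hle (r := c * (χ v - ε / c)) (hv.smul c) (by convert h1 using 1; module)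
    have h3 : c * (χ v - ε / c) = c * χ v - ε := by field_simp
    linarith
  have hpos' : ∀ {v : E} {c : ℝ}, InIdeal e v → 0 < c → χ (c • v) = c * χ v := by
    intro v c hv hc
    refine le_antisymm ?_ (hpos hv hc)
    have := hpos (hv.smul c) (inv_pos.2 hc)
    rw [smul_smul, inv_mul_cancel₀ hc.ne', one_smul, inv_mul_le_iff₀ hc] at this
    exact this
  have h00 : InIdeal e (0 : E) := ⟨0, le_rfl, by simp, by simp⟩
  refine ⟨χ, ⟨he, ?_, ?_, ?_, ?_⟩, hle hke (by simpa using hkQ)⟩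
  · exact le_antisymm (hge (InIdeal.self he) (hQ.of_nonneg (by simp)))
      (hle (InIdeal.self he) (hQ.of_nonneg (by simp)))
  · intro v w hv hw
    apply le_antisymm
    · refine le_of_forall_pos_le_add fun ε hε => hge (hv.add hw) ?_
      have := hQ.add (hb hv (show χ v < χ v + ε / 2 by linarith))
        (hb hw (show χ w < χ w + ε / 2 by linarith))
      convert this using 1
      module
    · refine le_of_forall_pos_le_add fun ε hε => ?_
      have := hQ.add (ha hv (show χ v - ε / 2 < χ v by linarith))
        (ha hw (show χ w - ε / 2 < χ w by linarith))
      have h2 := hle (r := χ v + χ w - ε) (hv.add hw) (by convert this using 1; module)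
      linarith
  · intro v c hv
    rcases lt_trichotomy c 0 with hc | hc | hc
    · have h1 := hpos' hv (neg_pos.2 hc)
      rw [neg_smul, hneg' (hv.smul c)] at h1
      linarith
    · subst hc
      have := hneg' h00
      rw [neg_zero] at this
      rw [zero_smul, zero_mul]; linarith
    · exact hpos' hv hc
  · intro v w hv hw
    have hmono : ∀ {v w : E}, InIdeal e v → InIdeal e w → v ≤ w → χ v ≤ χ w := by
      intro v w hv hw hvw
      refine le_of_forall_pos_le_add fun ε hε => ?_
      have := hle hw (hQ.mono (ha hv (show χ v - ε < χ v by linarith)) (sub_le_sub_right hvw _))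
      linarith
    apply le_antisymm
    · exact le_min (hmono (hv.inf he hw) hv inf_le_left) (hmono (hv.inf he hw) hw inf_le_right)
    · refine le_of_forall_pos_le_add fun ε hε => ?_
      have h1 := min_le_left (χ v) (χ w)
      have h2 := min_le_right (χ v) (χ w)
      have := hQ.inf (ha hv (show min (χ v) (χ w) - ε < χ v by linarith))
        (ha hw (show min (χ v) (χ w) - ε < χ w by linarith))
      have h3 := hle (r := min (χ v) (χ w) - ε) (hv.inf he hw) (by
        rw [inf_sub]; exact this)
      linarith

/-- An inequality that holds at all real points of a principal ideal holds in the lattice. -/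
theorem nonpos_of_forall_realPoint [HasSolidNorm E] {e k : E} (he : 0 ≤ e) (hke : InIdeal e k)
    (h : ∀ χ : E → ℝ, IsRealPoint e χ → χ k ≤ 0) : k ≤ 0 := by
  have key : ∀ ε : ℝ, 0 < ε → k ≤ ε • e := by
    intro ε hε
    by_contra hcon
    -- Since `exists_realPoint` yields only a weak inequality, it is applied to `k - ε • e`;
    -- closedness of the cone removes `ε` afterwards.
    obtain ⟨χ, hχ, h1⟩ := exists_realPoint he (hke.sub ((InIdeal.self he).smul ε))
      (fun h' => hcon (sub_nonpos.1 h'))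
    rw [hχ.sub hke ((InIdeal.self he).smul ε), hχ.smul ε (InIdeal.self he), hχ.unit] at h1
    linarith [h χ hχ]
  have hlim : Tendsto (fun ε : ℝ => ε • e) (𝓝[>] 0) (𝓝 0) := by
    have : Tendsto (fun ε : ℝ => ε • e) (𝓝 0) (𝓝 ((0 : ℝ) • e)) :=
      (continuous_id.smul continuous_const).tendsto 0
    rw [zero_smul] at this
    exact this.mono_left nhdsWithin_le_nhds
  exact ge_of_tendsto hlim (eventually_nhdsWithin_of_forall key)

theorem le_of_forall_realPoint [HasSolidNorm E] {e v w : E} (he : 0 ≤ e) (hv : InIdeal e v)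
    (hw : InIdeal e w) (h : ∀ χ : E → ℝ, IsRealPoint e χ → χ v ≤ χ w) : v ≤ w := by
  refine sub_nonpos.1 (nonpos_of_forall_realPoint he (hv.sub hw) fun χ hχ => ?_)
  rw [hχ.sub hv hw]
  exact sub_nonpos.2 (h χ hχ)

end RealPoints

/-! ### Triangular waves in a vector lattice. -/

section Wave

/-- The distance of `x` to the multiples `k • p`, `|k| ≤ n`, in a vector lattice. -/
def wave {α : Type*} [AddCommGroup α] [Lattice α] [Module ℝ α] (x p : α) : ℕ → α
  | 0 => |x|
  | n + 1 => wave x p n ⊓ (|x - ((n : ℝ) + 1) • p| ⊓ |x + ((n : ℝ) + 1) • p|)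

/-- At a half-integer `m` need not be `round x`, but both are then at distance `1 / 2`. -/
theorem abs_sub_round_eq {x : ℝ} {m : ℤ} (h : |x - m| ≤ 1 / 2) : |x - round x| = |x - m| := by
  apply le_antisymm (round_le x m)
  by_cases hm : round x = m
  · rw [hm]
  · have h1 : (1 : ℝ) ≤ |((m - round x : ℤ) : ℝ)| := by
      rw [← Int.cast_abs]
      exact_mod_cast Int.one_le_abs (sub_ne_zero.2 (Ne.symm hm))
    have h2 : |((m - round x : ℤ) : ℝ)| ≤ |x - round x| + |x - m| := by
      push_cast
      rw [show (m : ℝ) - round x = (x - round x) - (x - m) by ring]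
      exact abs_sub _ _
    linarith

/-- Between consecutive half-integers the distance to the integers is affine; the parity of `n`
decides whether its slope is `1` or `-1`. -/
theorem abs_sub_round_isometry {x y : ℝ} {n : ℤ} (hx : (n : ℝ) / 2 ≤ x) (hx' : x ≤ (n + 1) / 2)
    (hy : (n : ℝ) / 2 ≤ y) (hy' : y ≤ (n + 1) / 2) :
    abs (|x - round x| - |y - round y|) = |x - y| := by
  rcases Int.even_or_odd' n with ⟨m, hm | hm⟩
  · subst hm
    push_cast at *
    have e1 : |x - m| = x - m := abs_of_nonneg (by linarith)
    have e2 : |y - m| = y - m := abs_of_nonneg (by linarith)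
    rw [abs_sub_round_eq (m := m) (by rw [e1]; linarith),
      abs_sub_round_eq (m := m) (by rw [e2]; linarith), e1, e2]
    congr 1; ring
  · subst hm
    push_cast at *
    have e1 : |x - (m + 1 : ℤ)| = m + 1 - x := by
      rw [abs_of_nonpos] <;> push_cast <;> linarith
    have e2 : |y - (m + 1 : ℤ)| = m + 1 - y := by
      rw [abs_of_nonpos] <;> push_cast <;> linarith
    rw [abs_sub_round_eq (m := m + 1) (by rw [e1]; linarith),
      abs_sub_round_eq (m := m + 1) (by rw [e2]; linarith), e1, e2, abs_sub_comm x y]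
    congr 1; ring

/-- At small scale, one of two phase-shifted triangular waves is isometric. -/
theorem abs_sub_le_abs_sub_round_add {x y : ℝ} (h : |x - y| ≤ 1 / 4) :
    |x - y| ≤ abs (|x - round x| - |y - round y|) +
      abs (|x + 1 / 4 - round (x + 1 / 4)| - |y + 1 / 4 - round (y + 1 / 4)|) := by
  wlog hxy : x ≤ y generalizing x y
  · have := this (x := y) (y := x) (by rwa [abs_sub_comm]) (le_of_not_ge hxy)
    rw [abs_sub_comm x y, abs_sub_comm (|x - round x|),
      abs_sub_comm (|x + 1 / 4 - round (x + 1 / 4)|)]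
    exact this
  have hd : y - x ≤ 1 / 4 := by
    rw [abs_sub_comm, abs_of_nonneg (by linarith)] at h; exact h
  have h1 := Int.floor_le (2 * x)
  have h2 := Int.lt_floor_add_one (2 * x)
  set n := ⌊2 * x⌋
  by_cases hy : y ≤ ((n : ℝ) + 1) / 2
  · rw [abs_sub_round_isometry (n := n) (by linarith) (by linarith) (by linarith) hy]
    linarith [abs_nonneg (|x + 1 / 4 - round (x + 1 / 4)| -
      |y + 1 / 4 - round (y + 1 / 4)|)]
  · push Not at hy
    -- Here `y` is beyond the corner `(n + 1) / 2` and `x` less than `1 / 4` before it, so the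
    -- quarter shift brings both into the next interval of length `1 / 2`.
    rw [abs_sub_round_isometry (x := x + 1 / 4) (y := y + 1 / 4) (n := n + 1)
      (by push_cast; linarith) (by push_cast; linarith) (by push_cast; linarith)
      (by push_cast; linarith)]
    have := abs_nonneg (|x - round x| - |y - round y|)
    rw [show x + 1 / 4 - (y + 1 / 4) = x - y by ring]
    linarith

theorem mul_abs_sub_round_le_wave {x p : ℝ} (hp : 0 < p) (n : ℕ) :
    p * |x / p - round (x / p)| ≤ wave x p n := by
  have key : ∀ k : ℤ, p * |x / p - round (x / p)| ≤ |x - k * p| := by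
    intro k
    have h1 := mul_le_mul_of_nonneg_left (round_le (x / p) k) hp.le
    have h2 : p * |x / p - k| = |x - k * p| := by
      rw [← abs_of_pos hp, ← abs_mul, abs_of_pos hp]
      congr 1; field_simp
    rwa [h2] at h1
  induction n with
  | zero => simpa [wave] using key 0
  | succ n ih =>
    refine le_inf ih (le_inf ?_ ?_)
    · have := key (n + 1); push_cast at this; simpa using this
    · have := key (-(n + 1))
      have e : ((-((n : ℤ) + 1) : ℤ) : ℝ) = -((n : ℝ) + 1) := by push_cast; rfl
      rw [e, neg_mul, sub_neg_eq_add] at this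
      exact this

theorem wave_le {x p : ℝ} (n : ℕ) {k : ℤ} (hk : |k| ≤ n) : wave x p n ≤ |x - k * p| := by
  induction n with
  | zero =>
    have : k = 0 := by simpa using hk
    subst this; simp [wave]
  | succ n ih =>
    by_cases hk' : |k| ≤ n
    · exact inf_le_left.trans (ih hk')
    · have h1 : |k| = n + 1 := by push_cast at hk; omega
      rcases abs_eq (by positivity : (0 : ℤ) ≤ n + 1) |>.1 h1 with h | h
      · refine inf_le_right.trans (inf_le_left.trans (le_of_eq ?_))
        rw [h]; push_cast; simp
      · refine inf_le_right.trans (inf_le_right.trans (le_of_eq ?_))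
        rw [h]; push_cast; simp only [smul_eq_mul]; congr 1; ring

theorem wave_eq {x p : ℝ} (hp : 0 < p) {n : ℕ} (h : |x| ≤ n * p) :
    wave x p n = p * |x / p - round (x / p)| := by
  apply le_antisymm _ (mul_abs_sub_round_le_wave hp n)
  have h0 : |x / p| ≤ n := by rw [abs_div, abs_of_pos hp]; exact (div_le_iff₀ hp).2 h
  have h1 : |round (x / p)| ≤ (n : ℤ) := by
    obtain ⟨h2, h3⟩ := abs_le.1 h0
    have h4 := abs_le.1 (abs_sub_round (x / p))
    rw [abs_le]
    constructor
    · have : ((-n - 1 : ℤ) : ℝ) < round (x / p) := by push_cast; linarith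
      have := Int.cast_lt.1 this; omega
    · have : (round (x / p) : ℝ) < ((n + 1 : ℤ) : ℝ) := by push_cast; linarith
      have := Int.cast_lt.1 this; omega
  refine (wave_le n h1).trans (le_of_eq ?_)
  rw [← abs_of_pos hp, ← abs_mul, abs_of_pos hp]
  congr 1; field_simp

theorem real_wave_le {x p : ℝ} (hp : 0 ≤ p) {n : ℕ} (h : |x| ≤ n * p) :
    wave x p n ≤ p / 2 := by
  rcases hp.eq_or_lt with hp | hp
  · subst hp
    have hx : x = 0 := by simpa using h
    have := wave_le (x := x) (p := 0) n (k := 0) (by simp)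
    simpa [hx] using this
  · rw [wave_eq hp h]
    have := abs_sub_round (x / p)
    nlinarith

/-- The two waves of period `8 * s * u` are a quarter period apart. The normalized values `x / u`
and `x' / u'` differ by at most `2 * s`, a quarter of `8 * s`, so `abs_sub_le_abs_sub_round_add`
applies. The last two terms pay for `u' ≠ u`: once in normalizing `x'`, once in the amplitudes. -/
theorem real_wave_ineq {x x' u u' s δ : ℝ} {n : ℕ} (hs : 0 < s) (hδ : 0 ≤ δ) (hδ1 : δ ≤ 1)
    (hδs : 2 * δ ≤ s) (hx : |x| ≤ u) (hx' : |x'| ≤ u') (hxx : |x' - x| ≤ s * u)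
    (huu : u' ≤ (1 + δ) * u) (huu' : u ≤ (1 + δ) * u') (hn : 1 + 2 * s ≤ n * (8 * s)) :
    |x' - x| ≤ |wave x' ((8 * s) * u') n - wave x ((8 * s) * u) n| +
      |wave (x' + (2 * s) * u') ((8 * s) * u') n - wave (x + (2 * s) * u) ((8 * s) * u) n| +
      δ * |x'| + 8 * s * δ * u' := by
  have hu : 0 ≤ u := (abs_nonneg x).trans hx
  have hu' : 0 ≤ u' := (abs_nonneg x').trans hx'
  rcases hu.eq_or_lt with h0 | hupos
  · subst h0
    have h1 : |x' - x| ≤ 0 := by simpa using hxx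
    have := abs_nonneg (wave x' ((8 * s) * u') n - wave x ((8 * s) * 0) n)
    have := abs_nonneg (wave (x' + (2 * s) * u') ((8 * s) * u') n -
      wave (x + (2 * s) * 0) ((8 * s) * 0) n)
    have : 0 ≤ δ * |x'| := by positivity
    have : 0 ≤ 8 * s * δ * u' := by positivity
    linarith
  have hupos' : 0 < u' := by
    by_contra h
    have : u' = 0 := le_antisymm (not_lt.1 h) hu'
    rw [this] at huu'; simp at huu'; linarith
  have hd : |u' - u| ≤ δ * u' := by
    rw [abs_le]
    constructor
    · linarith
    · have : (1 - δ) * u' ≤ (1 - δ) * ((1 + δ) * u) :=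
        mul_le_mul_of_nonneg_left huu (by linarith)
      have : 0 ≤ δ ^ 2 * u := by positivity
      nlinarith
  set a := x / u with ha
  set a' := x' / u' with ha'
  have hxa : x = a * u := by rw [ha]; field_simp
  have hxa' : x' = a' * u' := by rw [ha']; field_simp
  have hw : ∀ {b v : ℝ}, 0 < v → |b| ≤ 1 + 2 * s →
      wave (b * v) ((8 * s) * v) n =
        (8 * s * v) * |b / (8 * s) - round (b / (8 * s))| := by
    intro b v hv hb
    rw [wave_eq (by positivity)]
    · rw [show b * v / (8 * s * v) = b / (8 * s) by field_simp]
    · rw [abs_mul, abs_of_pos hv]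
      nlinarith
  have hab : |a| ≤ 1 := by rw [ha, abs_div, abs_of_pos hupos]; exact div_le_one_of_le₀ hx hu
  have hab' : |a'| ≤ 1 := by
    rw [ha', abs_div, abs_of_pos hupos']; exact div_le_one_of_le₀ hx' hu'
  have hshift : ∀ {b : ℝ}, |b| ≤ 1 → |b + 2 * s| ≤ 1 + 2 * s := by
    intro b hb
    refine (abs_add_le _ _).trans ?_
    rw [abs_of_pos (show 0 < 2 * s by linarith)]
    linarith
  have e1 : x + 2 * s * u = (a + 2 * s) * u := by rw [hxa]; ring
  have e2 : x' + 2 * s * u' = (a' + 2 * s) * u' := by rw [hxa']; ring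
  have e3 : ∀ b : ℝ, (b + 2 * s) / (8 * s) = b / (8 * s) + 1 / 4 := by
    intro b; field_simp; ring
  have hax : u * |a' - a| ≤ |x' - x| + δ * |x'| ∧ |x' - x| ≤ u * |a' - a| + δ * |x'| := by
    have h1 : u * |a' - a| = |(x' - x) - a' * (u' - u)| := by
      rw [← abs_of_pos hupos, ← abs_mul, abs_of_pos hupos]
      congr 1; rw [hxa', hxa]; ring
    have h2 : |a' * (u' - u)| ≤ δ * |x'| := by
      rw [hxa', abs_mul, abs_mul, abs_of_pos hupos']
      nlinarith [abs_nonneg a']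
    constructor
    · rw [h1]; exact (abs_sub _ _).trans (by linarith)
    · have := abs_sub_abs_le_abs_sub (x' - x) (a' * (u' - u))
      rw [h1]; linarith
  have hsmall : |a' / (8 * s) - a / (8 * s)| ≤ 1 / 4 := by
    rw [← sub_div, abs_div, abs_of_pos (show 0 < 8 * s by linarith), div_le_iff₀ (by linarith)]
    have h1 : δ * |x'| ≤ s * u := by
      have : δ * |x'| ≤ δ * ((1 + δ) * u) := mul_le_mul_of_nonneg_left (hx'.trans huu) hδ
      have : δ * ((1 + δ) * u) ≤ δ * (2 * u) := by gcongr; linarith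
      have : 2 * δ * u ≤ s * u := by gcongr
      linarith
    have h2 : u * |a' - a| ≤ u * (2 * s) := by linarith [hax.1]
    have := le_of_mul_le_mul_left h2 hupos
    linarith
  have hkey := abs_sub_le_abs_sub_round_add hsmall
  rw [← sub_div, abs_div, abs_of_pos (show 0 < 8 * s by linarith)] at hkey
  rw [e1, e2, hxa, hxa', hw hupos (hab.trans (by linarith)), hw hupos' (hab'.trans (by linarith)),
    hw hupos (hshift hab), hw hupos' (hshift hab'), e3, e3, ← hxa, ← hxa']
  -- Replacing `u` by `u'` in one amplitude costs `8 * s * |u' - u| * |d'|` with `|d'| ≤ 1 / 2`,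
  -- that is, half of the final error term for each wave.
  have hest : ∀ d d' : ℝ, |d'| ≤ 1 / 2 →
      8 * s * u * |d' - d| ≤ |8 * s * u' * d' - 8 * s * u * d| + 4 * s * δ * u' := by
    intro d d' hd'
    have h1 : 8 * s * u * |d' - d| =
        |(8 * s * u' * d' - 8 * s * u * d) - 8 * s * ((u' - u) * d')| := by
      rw [← abs_of_pos (show 0 < 8 * s * u by positivity), ← abs_mul,
        abs_of_pos (show 0 < 8 * s * u by positivity)]
      congr 1; ring
    rw [h1]
    refine (abs_sub _ _).trans (add_le_add le_rfl ?_)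
    rw [abs_mul, abs_mul (u' - u), abs_of_pos (show 0 < 8 * s by positivity)]
    have : |u' - u| * |d'| ≤ δ * u' * (1 / 2) :=
      mul_le_mul hd hd' (abs_nonneg _) (by positivity)
    nlinarith
  have h1 := hest |a / (8 * s) - round (a / (8 * s))| |a' / (8 * s) - round (a' / (8 * s))|
    (by rw [abs_abs]; exact abs_sub_round _)
  have h2 := hest |a / (8 * s) + 1 / 4 - round (a / (8 * s) + 1 / 4)|
    |a' / (8 * s) + 1 / 4 - round (a' / (8 * s) + 1 / 4)| (by rw [abs_abs]; exact abs_sub_round _)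
  have h3 := mul_le_mul_of_nonneg_left hkey (show 0 ≤ 8 * s * u by positivity)
  rw [mul_add] at h3
  have h4 : 8 * s * u * (|a' - a| / (8 * s)) = u * |a' - a| := by field_simp
  rw [h4] at h3
  linarith [hax.2]

variable {E : Type*} [NormedAddCommGroup E] [NormedSpace ℝ E] [Lattice E] [IsOrderedAddMonoid E]
  [IsOrderedModule ℝ E]

theorem InIdeal.wave {e x p : E} (he : 0 ≤ e) (hx : InIdeal e x) (hp : InIdeal e p) (n : ℕ) :
    InIdeal e (wave x p n) := by
  induction n with
  | zero => exact hx.abs he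
  | succ n ih =>
    exact ih.inf he (((hx.sub (hp.smul _)).abs he).inf he ((hx.add (hp.smul _)).abs he))

theorem IsRealPoint.wave {e x p : E} {χ : E → ℝ} (h : IsRealPoint e χ) (hx : InIdeal e x)
    (hp : InIdeal e p) (n : ℕ) : χ (wave x p n) = wave (χ x) (χ p) n := by
  have he := h.nonneg
  induction n with
  | zero => exact h.abs hx
  | succ n ih =>
    have h1 := hx.sub (hp.smul ((n : ℝ) + 1))
    have h2 := hx.add (hp.smul ((n : ℝ) + 1))
    simp only [_root_.wave]
    rw [h.inf (hx.wave he hp n) ((h1.abs he).inf he (h2.abs he)), ih,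
      h.inf (h1.abs he) (h2.abs he), h.abs h1, h.abs h2, h.sub hx (hp.smul _),
      h.add hx (hp.smul _), h.smul _ hp]
    rfl

theorem wave_nonneg (x p : E) (n : ℕ) : 0 ≤ wave x p n := by
  induction n with
  | zero => exact abs_nonneg x
  | succ n ih => exact le_inf ih (le_inf (abs_nonneg _) (abs_nonneg _))

/-- The amplitude is proportional to the period; this later supplies the decisive factor `s`. -/
theorem wave_le_half [HasSolidNorm E] {x p : E} (hp : 0 ≤ p) {n : ℕ} (h : |x| ≤ (n : ℝ) • p) :
    wave x p n ≤ (2⁻¹ : ℝ) • p := by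
  have hpp := InIdeal.self hp
  have hx : InIdeal p x := InIdeal.of_abs_le (hpp.smul n) h
  refine le_of_forall_realPoint hp (hx.wave hp hpp n) (hpp.smul _) fun χ hχ => ?_
  rw [hχ.wave hx hpp, hχ.smul _ hpp]
  have h1 := hχ.mono (hx.abs hp) (hpp.smul _) h
  rw [hχ.abs hx, hχ.smul _ hpp] at h1
  refine (real_wave_le (by rw [hχ.unit]; exact zero_le_one) h1).trans (le_of_eq (by ring))

/-- All vectors involved lie in the ideal generated by `u + u'`, so `real_wave_ineq` at its real
points suffices. -/
theorem wave_ineq [HasSolidNorm E] {x x' u u' : E} {s δ : ℝ} {n : ℕ} (hs : 0 < s) (hδ : 0 ≤ δ)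
    (hδ1 : δ ≤ 1) (hδs : 2 * δ ≤ s) (hx : |x| ≤ u) (hx' : |x'| ≤ u') (hxx : |x' - x| ≤ s • u)
    (huu : u' ≤ (1 + δ) • u) (huu' : u ≤ (1 + δ) • u') (hn : 1 + 2 * s ≤ n * (8 * s)) :
    |x' - x| ≤ |wave x' ((8 * s) • u') n - wave x ((8 * s) • u) n| +
      |wave (x' + (2 * s) • u') ((8 * s) • u') n - wave (x + (2 * s) • u) ((8 * s) • u) n| +
      δ • |x'| + (8 * s * δ) • u' := by
  have hu : 0 ≤ u := (abs_nonneg x).trans hx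
  have hu' : 0 ≤ u' := (abs_nonneg x').trans hx'
  have he : 0 ≤ u + u' := add_nonneg hu hu'
  have iu : InIdeal (u + u') u := InIdeal.of_abs_le (InIdeal.self he) (by
    rw [abs_of_nonneg hu]; exact le_add_of_nonneg_right hu')
  have iu' : InIdeal (u + u') u' := InIdeal.of_abs_le (InIdeal.self he) (by
    rw [abs_of_nonneg hu']; exact le_add_of_nonneg_left hu)
  have ix : InIdeal (u + u') x := InIdeal.of_abs_le iu hx
  have ix' : InIdeal (u + u') x' := InIdeal.of_abs_le iu' hx'
  have i1 := (ix'.wave he (iu'.smul (8 * s)) n).sub (ix.wave he (iu.smul (8 * s)) n)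
  have iy := ix.add (iu.smul (2 * s))
  have iy' := ix'.add (iu'.smul (2 * s))
  have i2 := (iy'.wave he (iu'.smul (8 * s)) n).sub (iy.wave he (iu.smul (8 * s)) n)
  have i3 := (i1.abs he).add (i2.abs he)
  have i4 := (ix'.abs he).smul δ
  refine le_of_forall_realPoint he ((ix'.sub ix).abs he)
    ((i3.add i4).add (iu'.smul _)) fun χ hχ => ?_
  rw [hχ.abs (ix'.sub ix), hχ.sub ix' ix, hχ.add (i3.add i4) (iu'.smul _), hχ.add i3 i4,
    hχ.add (i1.abs he) (i2.abs he), hχ.abs i1, hχ.abs i2,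
    hχ.sub (ix'.wave he (iu'.smul (8 * s)) n) (ix.wave he (iu.smul (8 * s)) n),
    hχ.sub (iy'.wave he (iu'.smul (8 * s)) n) (iy.wave he (iu.smul (8 * s)) n),
    hχ.wave ix' (iu'.smul _), hχ.wave ix (iu.smul _), hχ.wave iy' (iu'.smul _),
    hχ.wave iy (iu.smul _), hχ.add ix' (iu'.smul _), hχ.add ix (iu.smul _),
    hχ.smul _ iu', hχ.smul _ iu, hχ.smul _ iu', hχ.smul _ iu, hχ.smul _ (ix'.abs he), hχ.abs ix',
    hχ.smul _ iu']
  have m1 := hχ.mono (ix.abs he) iu hx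
  have m2 := hχ.mono (ix'.abs he) iu' hx'
  have m3 := hχ.mono ((ix'.sub ix).abs he) (iu.smul s) hxx
  have m4 := hχ.mono iu' (iu.smul _) huu
  have m5 := hχ.mono iu (iu'.smul _) huu'
  rw [hχ.abs ix] at m1
  rw [hχ.abs ix'] at m2
  rw [hχ.abs (ix'.sub ix), hχ.sub ix' ix, hχ.smul _ iu] at m3
  rw [hχ.smul _ iu] at m4
  rw [hχ.smul _ iu'] at m5
  exact real_wave_ineq hs hδ hδ1 hδs m1 m2 m3 m4 m5 hn

end Wave

/-! ### Defects and the vector lattice of coherent sequences. -/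

section Defect

variable {E : Type*} [NormedAddCommGroup E] [NormedSpace ℝ E] [Lattice E] [IsOrderedAddMonoid E]
  [IsOrderedModule ℝ E]

theorem lattice_abs_smul (c : ℝ) (v : E) : |c • v| = |c| • |v| := by
  have key : ∀ {c : ℝ} {v : E}, 0 ≤ c → |c • v| ≤ c • |v| := by
    intro c v hc
    refine sup_le (smul_le_smul_of_nonneg_left (le_abs_self v) hc) ?_
    rw [← smul_neg]
    exact smul_le_smul_of_nonneg_left (neg_le_abs v) hc
  have key' : ∀ {c : ℝ} {v : E}, 0 < c → |c • v| = c • |v| := by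
    intro c v hc
    refine le_antisymm (key hc.le) ?_
    have h1 := key (c := c⁻¹) (v := c • v) (inv_nonneg.2 hc.le)
    rw [smul_smul, inv_mul_cancel₀ hc.ne', one_smul] at h1
    have h2 := smul_le_smul_of_nonneg_left h1 hc.le
    rwa [smul_smul, mul_inv_cancel₀ hc.ne', one_smul] at h2
  rcases lt_trichotomy c 0 with hc | hc | hc
  · rw [abs_of_neg hc, ← key' (neg_pos.2 hc), neg_smul, abs_neg]
  · simp [hc]
  · rw [key' hc, abs_of_pos hc]

/-- Positivity of a bounded operator. -/
def IsPositiveOperator (R : E →L[ℝ] E) : Prop := ∀ f : E, 0 ≤ f → 0 ≤ R f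

theorem IsPositiveOperator.mono {R : E →L[ℝ] E} (hR : IsPositiveOperator R) {f g : E}
    (h : f ≤ g) : R f ≤ R g := by
  have := hR (g - f) (sub_nonneg.2 h)
  rwa [map_sub, sub_nonneg] at this

theorem IsPositiveOperator.abs_apply_le {R : E →L[ℝ] E} (hR : IsPositiveOperator R) (f : E) :
    |R f| ≤ R |f| := by
  refine sup_le (hR.mono (le_abs_self f)) ?_
  rw [← map_neg]
  exact hR.mono (neg_le_abs f)

theorem IsPositiveOperator.pow {R : E →L[ℝ] E} (hR : IsPositiveOperator R) (n : ℕ) :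
    IsPositiveOperator (R ^ n) := by
  induction n with
  | zero => intro f hf; simpa using hf
  | succ n ih => intro f hf; rw [pow_succ']; exact hR _ (ih f hf)

/-- The sums `∑_{j < n} R ^ (n - 1 - j) |G j|`, which transport `|G 0|, …, |G (n - 1)|` to the
time `n - 1`. -/
def defectSum (R : E →L[ℝ] E) (G : ℕ → E) : ℕ → E
  | 0 => 0
  | n + 1 => R (defectSum R G n) + |G n|

variable {R : E →L[ℝ] E}

theorem defectSum_nonneg (hR : IsPositiveOperator R) (G : ℕ → E) (n : ℕ) :
    0 ≤ defectSum R G n := by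
  induction n with
  | zero => exact le_rfl
  | succ n ih => exact add_nonneg (hR _ ih) (abs_nonneg _)

theorem defectSum_mono (hR : IsPositiveOperator R) {G H : ℕ → E} (h : ∀ j, |G j| ≤ |H j|)
    (n : ℕ) : defectSum R G n ≤ defectSum R H n := by
  induction n with
  | zero => exact le_rfl
  | succ n ih => exact add_le_add (hR.mono ih) (h n)

theorem defectSum_add_le (hR : IsPositiveOperator R) (G H : ℕ → E) (n : ℕ) :
    defectSum R (fun j => G j + H j) n ≤ defectSum R G n + defectSum R H n := by
  induction n with
  | zero => simp [defectSum]
  | succ n ih =>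
    have h1 := add_le_add (hR.mono ih) (abs_add_le (G n) (H n))
    rw [map_add] at h1
    refine h1.trans (le_of_eq ?_)
    simp only [defectSum]
    abel

theorem defectSum_succ (G : ℕ → E) (n : ℕ) :
    defectSum R G (n + 1) = (R ^ n) |G 0| + defectSum R (fun j => G (j + 1)) n := by
  induction n with
  | zero => simp [defectSum]
  | succ n ih =>
    have : defectSum R G (n + 1 + 1) = R (defectSum R G (n + 1)) + |G (n + 1)| := rfl
    rw [this, ih, map_add, pow_succ']
    simp only [defectSum]
    rw [add_assoc]
    rfl

theorem defectSum_map_le (hR : IsPositiveOperator R) (G : ℕ → E) (n : ℕ) :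
    defectSum R (fun j => R (G j)) n ≤ R (defectSum R G n) := by
  induction n with
  | zero => simp [defectSum]
  | succ n ih =>
    simp only [defectSum, map_add]
    exact add_le_add (hR.mono ih) (hR.abs_apply_le _)

theorem defectSum_smul (c : ℝ) (G : ℕ → E) (n : ℕ) :
    defectSum R (fun j => c • G j) n = |c| • defectSum R G n := by
  induction n with
  | zero => simp [defectSum]
  | succ n ih =>
    simp only [defectSum]
    rw [ih, lattice_abs_smul, map_smul, smul_add]

variable [HasSolidNorm E]

theorem norm_le_of_nonneg_of_le {a b : E} (ha : 0 ≤ a) (h : a ≤ b) : ‖a‖ ≤ ‖b‖ :=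
  norm_le_norm_of_abs_le_abs (by rwa [abs_of_nonneg ha, abs_of_nonneg (ha.trans h)])

theorem norm_pow_defectSum_le {M g : ℝ} (hM : ∀ n : ℕ, ‖R ^ n‖ ≤ M) {G : ℕ → E}
    (hG : ∀ j, ‖G j‖ ≤ g) (n k : ℕ) : ‖(R ^ k) (defectSum R G n)‖ ≤ M * g * n := by
  have hM0 : 0 ≤ M := (norm_nonneg _).trans (hM 0)
  induction n generalizing k with
  | zero => simp [defectSum]
  | succ n ih =>
    have h1 : (R ^ k) (defectSum R G (n + 1)) =
        (R ^ (k + 1)) (defectSum R G n) + (R ^ k) |G n| := by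
      simp only [defectSum, map_add]
      rw [pow_succ]; rfl
    rw [h1]
    refine (norm_add_le _ _).trans ?_
    have h2 : ‖(R ^ k) |G n|‖ ≤ M * g := by
      refine ((R ^ k).le_opNorm _).trans ?_
      rw [norm_abs_eq_norm]
      exact mul_le_mul (hM k) (hG n) (norm_nonneg _) hM0
    have := ih (k + 1)
    rw [Nat.cast_succ]
    linarith

/-- The sequence `G` has defect at most `c` per time step. -/
def HasDefect (R : E →L[ℝ] E) (G : ℕ → E) (c : ℝ) : Prop :=
  ∃ C : ℝ, ∀ n : ℕ, ‖defectSum R G n‖ ≤ c * n + C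

theorem HasDefect.of_le (hR : IsPositiveOperator R) {G H : ℕ → E} {c : ℝ} (h : HasDefect R H c)
    (hGH : ∀ j, |G j| ≤ |H j|) : HasDefect R G c := by
  obtain ⟨C, hC⟩ := h
  exact ⟨C, fun n => (norm_le_of_nonneg_of_le (defectSum_nonneg hR G n)
    (defectSum_mono hR hGH n)).trans (hC n)⟩

theorem HasDefect.weaken {G : ℕ → E} {c d : ℝ} (h : HasDefect R G c) (hcd : c ≤ d) :
    HasDefect R G d := by
  obtain ⟨C, hC⟩ := h
  refine ⟨C, fun n => (hC n).trans ?_⟩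
  gcongr

theorem HasDefect.add (hR : IsPositiveOperator R) {G H : ℕ → E} {c d : ℝ} (h : HasDefect R G c)
    (h' : HasDefect R H d) : HasDefect R (fun j => G j + H j) (c + d) := by
  obtain ⟨C, hC⟩ := h
  obtain ⟨D, hD⟩ := h'
  refine ⟨C + D, fun n => ?_⟩
  refine (norm_le_of_nonneg_of_le (defectSum_nonneg hR _ n) (defectSum_add_le hR G H n)).trans ?_
  refine (norm_add_le _ _).trans ?_
  linarith [hC n, hD n]

theorem HasDefect.smul {G : ℕ → E} {c : ℝ} (h : HasDefect R G c) (a : ℝ) :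
    HasDefect R (fun j => a • G j) (|a| * c) := by
  obtain ⟨C, hC⟩ := h
  refine ⟨|a| * C, fun n => ?_⟩
  rw [defectSum_smul, norm_smul, Real.norm_eq_abs, abs_abs]
  have := mul_le_mul_of_nonneg_left (hC n) (abs_nonneg a)
  linarith

theorem HasDefect.shift (hR : IsPositiveOperator R) {G : ℕ → E} {c : ℝ} (h : HasDefect R G c) :
    HasDefect R (fun j => G (j + 1)) c := by
  obtain ⟨C, hC⟩ := h
  refine ⟨c + C, fun n => ?_⟩
  refine (norm_le_of_nonneg_of_le (defectSum_nonneg hR _ n)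
    (b := defectSum R G (n + 1)) ?_).trans ?_
  · rw [defectSum_succ]
    exact le_add_of_nonneg_left (hR.pow n _ (abs_nonneg _))
  · have := hC (n + 1)
    push_cast at this
    linarith

theorem HasDefect.shift_add (hR : IsPositiveOperator R) {G : ℕ → E} {c : ℝ}
    (h : HasDefect R G c) (m : ℕ) : HasDefect R (fun j => G (j + m)) c := by
  induction m with
  | zero => exact h
  | succ m ih =>
    have := ih.shift hR
    convert this using 3
    ring

/-- The initial term contributes `(R ^ n) |G 0|`, bounded in `n`, which disappears in the additive
constant. -/
theorem HasDefect.of_shift {M : ℝ} (hM : ∀ n : ℕ, ‖R ^ n‖ ≤ M) {G : ℕ → E} {c : ℝ}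
    (h : HasDefect R (fun j => G (j + 1)) c) : HasDefect R G c := by
  obtain ⟨C, hC⟩ := h
  refine ⟨|C| + M * ‖G 0‖ + |c|, fun n => ?_⟩
  have hM0 : 0 ≤ M := (norm_nonneg _).trans (hM 0)
  cases n with
  | zero =>
    simp only [defectSum, norm_zero, Nat.cast_zero, mul_zero, zero_add]
    positivity
  | succ n =>
    rw [defectSum_succ]
    refine (norm_add_le _ _).trans ?_
    have h1 : ‖(R ^ n) |G 0|‖ ≤ M * ‖G 0‖ := by
      refine ((R ^ n).le_opNorm _).trans ?_
      rw [norm_abs_eq_norm]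
      gcongr
      exact hM n
    have := hC n
    have := le_abs_self C
    have := neg_abs_le c
    rw [Nat.cast_succ]
    linarith

theorem HasDefect.of_shift_add {M : ℝ} (hM : ∀ n : ℕ, ‖R ^ n‖ ≤ M) {G : ℕ → E} {c : ℝ} (m : ℕ)
    (h : HasDefect R (fun j => G (j + m)) c) : HasDefect R G c := by
  induction m with
  | zero => exact h
  | succ m ih =>
    refine ih (HasDefect.of_shift hM ?_)
    convert h using 3
    ring

theorem HasDefect.map (hR : IsPositiveOperator R) {M : ℝ} (hM : ∀ n : ℕ, ‖R ^ n‖ ≤ M)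
    {G : ℕ → E} {c : ℝ} (h : HasDefect R G c) : HasDefect R (fun j => R (G j)) (M * c) := by
  obtain ⟨C, hC⟩ := h
  refine ⟨M * C, fun n => ?_⟩
  refine (norm_le_of_nonneg_of_le (defectSum_nonneg hR _ n) (defectSum_map_le hR G n)).trans ?_
  have h1 : ‖R‖ ≤ M := by simpa using hM 1
  refine ((R.le_opNorm _).trans (mul_le_mul h1 (hC n) (norm_nonneg _)
    ((norm_nonneg _).trans h1))).trans (le_of_eq (by ring))

theorem HasDefect.of_bounded {M g : ℝ} (hM : ∀ n : ℕ, ‖R ^ n‖ ≤ M) {G : ℕ → E}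
    (hG : ∀ j, ‖G j‖ ≤ g) : HasDefect R G (M * g) :=
  ⟨0, fun n => by simpa using norm_pow_defectSum_le hM hG n 0⟩

/-- Sequences whose defect per time step is arbitrarily small. -/
def NullDefect (R : E →L[ℝ] E) (G : ℕ → E) : Prop := ∀ ε : ℝ, 0 < ε → HasDefect R G ε

theorem NullDefect.of_le (hR : IsPositiveOperator R) {G H : ℕ → E} (h : NullDefect R H)
    (hGH : ∀ j, |G j| ≤ |H j|) : NullDefect R G := fun ε hε => (h ε hε).of_le hR hGH

theorem NullDefect.add (hR : IsPositiveOperator R) {G H : ℕ → E} (h : NullDefect R G)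
    (h' : NullDefect R H) : NullDefect R (fun j => G j + H j) := by
  intro ε hε
  have := (h (ε / 2) (by positivity)).add hR (h' (ε / 2) (by positivity))
  rwa [add_halves] at this

theorem NullDefect.smul {G : ℕ → E} (h : NullDefect R G) (a : ℝ) :
    NullDefect R (fun j => a • G j) := by
  intro ε hε
  have ha : 0 < |a| + 1 := by positivity
  refine ((h (ε / (|a| + 1)) (by positivity)).smul a).weaken ?_
  rw [mul_div_assoc', div_le_iff₀ ha]
  nlinarith [abs_nonneg a]

theorem NullDefect.shift_add (hR : IsPositiveOperator R) {G : ℕ → E} (h : NullDefect R G) (m : ℕ) :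
    NullDefect R (fun j => G (j + m)) := fun ε hε => (h ε hε).shift_add hR m

theorem NullDefect.map (hR : IsPositiveOperator R) {M : ℝ} (hM : ∀ n : ℕ, ‖R ^ n‖ ≤ M)
    {G : ℕ → E} (h : NullDefect R G) : NullDefect R (fun j => R (G j)) := by
  intro ε hε
  have hM0 : 0 ≤ M := (norm_nonneg _).trans (hM 0)
  refine ((h (ε / (M + 1)) (by positivity)).map hR hM).weaken ?_
  rw [mul_div_assoc', div_le_iff₀ (by positivity)]
  nlinarith

/-- Bounded sequences on which `R` acts, up to null defect, as the shift. -/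
structure IsCoherent (R : E →L[ℝ] E) (w : ℕ → E) : Prop where
  bdd : ∃ C : ℝ, ∀ j, ‖w j‖ ≤ C
  null : NullDefect R (fun j => R (w j) - w (j + 1))

theorem IsCoherent.add (hR : IsPositiveOperator R) {v w : ℕ → E} (hv : IsCoherent R v)
    (hw : IsCoherent R w) : IsCoherent R (fun j => v j + w j) := by
  refine ⟨?_, ?_⟩
  · obtain ⟨C, hC⟩ := hv.bdd
    obtain ⟨D, hD⟩ := hw.bdd
    exact ⟨C + D, fun j => (norm_add_le _ _).trans (add_le_add (hC j) (hD j))⟩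
  · have := hv.null.add hR hw.null
    convert this using 2
    rw [map_add]; abel

theorem IsCoherent.smul {w : ℕ → E} (hw : IsCoherent R w) (c : ℝ) :
    IsCoherent R (fun j => c • w j) := by
  refine ⟨?_, ?_⟩
  · obtain ⟨D, hD⟩ := hw.bdd
    refine ⟨|c| * D, fun j => ?_⟩
    rw [norm_smul, Real.norm_eq_abs]
    exact mul_le_mul_of_nonneg_left (hD j) (abs_nonneg c)
  · have := hw.null.smul c
    convert this using 2
    rw [map_smul, smul_sub]

theorem IsCoherent.sub (hR : IsPositiveOperator R) {v w : ℕ → E} (hv : IsCoherent R v)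
    (hw : IsCoherent R w) : IsCoherent R (fun j => v j - w j) := by
  have := hv.add hR (hw.smul (-1))
  convert this using 2
  rw [neg_one_smul, sub_eq_add_neg]

/-- The nonnegative losses `R |w j| - |R (w j)|` telescope, because `|R (w j)|` is `|w (j + 1)|` up
to the coherence error. -/
theorem defectSum_lattice_le (hR : IsPositiveOperator R) (w : ℕ → E) (n : ℕ) :
    defectSum R (fun j => R |w j| - |R (w j)|) n ≤
      (R ^ n) |w 0| - |w n| + defectSum R (fun j => R (w j) - w (j + 1)) n := by
  induction n with
  | zero => simp [defectSum]
  | succ n ih =>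
    have h1 := hR.mono ih
    simp only [defectSum]
    rw [abs_of_nonneg (sub_nonneg.2 (hR.abs_apply_le (w n)))]
    rw [map_add, map_sub] at h1
    have h2 : |w (n + 1)| ≤ |R (w n)| + |R (w n) - w (n + 1)| := by
      have := abs_add_le (R (w n)) (-(R (w n) - w (n + 1)))
      rwa [abs_neg, ← sub_eq_add_neg, sub_sub_cancel] at this
    have h3 : (R ^ (n + 1)) |w 0| = R ((R ^ n) |w 0|) := by rw [pow_succ']; rfl
    rw [h3]
    have h4 := add_le_add h1 h2
    rw [← sub_nonneg] at h4 ⊢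
    refine h4.trans (le_of_eq ?_)
    abel

/-- All losses together are at most `(R ^ n) |w 0|`, bounded in norm, plus a null defect. So on
coherent sequences `R` acts, up to null defect, as a lattice homomorphism. -/
theorem IsCoherent.abs (hR : IsPositiveOperator R) {M : ℝ} (hM : ∀ n : ℕ, ‖R ^ n‖ ≤ M)
    {w : ℕ → E} (hw : IsCoherent R w) : IsCoherent R (fun j => |w j|) := by
  have hfirst : NullDefect R (fun j => R |w j| - |R (w j)|) := by
    intro ε hε
    obtain ⟨C, hC⟩ := hw.null ε hε
    refine ⟨M * ‖w 0‖ + C, fun n => ?_⟩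
    have h1 : defectSum R (fun j => R |w j| - |R (w j)|) n ≤
        (R ^ n) |w 0| + defectSum R (fun j => R (w j) - w (j + 1)) n :=
      (defectSum_lattice_le hR w n).trans
        (add_le_add (sub_le_self _ (abs_nonneg _)) le_rfl)
    refine (norm_le_of_nonneg_of_le (defectSum_nonneg hR _ n) h1).trans ?_
    refine (norm_add_le _ _).trans ?_
    have h2 : ‖(R ^ n) |w 0|‖ ≤ M * ‖w 0‖ := by
      refine ((R ^ n).le_opNorm _).trans ?_
      rw [norm_abs_eq_norm]
      gcongr
      exact hM n
    linarith [hC n]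
  have hsecond : NullDefect R (fun j => |R (w j)| - |w (j + 1)|) :=
    hw.null.of_le hR fun j => abs_abs_sub_abs_le _ _
  refine ⟨?_, ?_⟩
  · obtain ⟨D, hD⟩ := hw.bdd
    exact ⟨D, fun j => by rw [norm_abs_eq_norm]; exact hD j⟩
  · have := hfirst.add hR hsecond
    convert this using 2
    abel

theorem IsCoherent.inf (hR : IsPositiveOperator R) {M : ℝ} (hM : ∀ n : ℕ, ‖R ^ n‖ ≤ M)
    {v w : ℕ → E} (hv : IsCoherent R v) (hw : IsCoherent R w) :
    IsCoherent R (fun j => v j ⊓ w j) := by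
  have := ((hv.add hR hw).sub hR ((hw.sub hR hv).abs hR hM)).smul 2⁻¹
  convert this using 2
  exact inf_eq_half_smul_add_sub_abs_sub' ℝ _ _

theorem IsCoherent.wave (hR : IsPositiveOperator R) {M : ℝ} (hM : ∀ n : ℕ, ‖R ^ n‖ ≤ M)
    {x p : ℕ → E} (hx : IsCoherent R x) (hp : IsCoherent R p) (n : ℕ) :
    IsCoherent R (fun j => wave (x j) (p j) n) := by
  induction n with
  | zero => exact hx.abs hR hM
  | succ n ih =>
    exact ih.inf hR hM (((hx.sub hR (hp.smul _)).abs hR hM).inf hR hM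
      ((hx.add hR (hp.smul _)).abs hR hM))

/-- The map `d ↦ l * d + (1 - l) * (ε / 2)` has the fixed point `ε / 2`, and its iterates approach
it geometrically from the initial rate `c`. Sequences given by discounted recursions have defects
that satisfy such a bound. -/
theorem nullDefect_of_contraction {G : ℕ → E} {c l : ℝ} (hl0 : 0 ≤ l) (hl : l < 1)
    (hG : HasDefect R G c)
    (h : ∀ d ε : ℝ, 0 < ε → HasDefect R G d → HasDefect R G (l * d + ε)) : NullDefect R G := by
  intro ε hε
  have h1 : ∀ k : ℕ, HasDefect R G (l ^ k * c + ε / 2) := by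
    intro k
    induction k with
    | zero => exact hG.weaken (by rw [pow_zero, one_mul]; linarith)
    | succ k ih =>
      have := h _ ((1 - l) * (ε / 2)) (mul_pos (by linarith) (by linarith)) ih
      convert this using 1
      ring
  have h2 : Tendsto (fun k : ℕ => l ^ k * c) atTop (𝓝 (0 * c)) :=
    (tendsto_pow_atTop_nhds_zero_of_lt_one hl0 hl).mul_const c
  rw [zero_mul] at h2
  obtain ⟨k, hk⟩ := (h2.eventually (gt_mem_nhds (show (0 : ℝ) < ε / 2 by positivity))).exists
  exact (h1 k).weaken (by linarith)

theorem hasDefect_of_norm_le {M C : ℝ} (hM : ∀ n : ℕ, ‖R ^ n‖ ≤ M) {w : ℕ → E}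
    (hw : ∀ j, ‖w j‖ ≤ C) : HasDefect R (fun j => R (w j) - w (j + 1)) (M * (M * C + C)) := by
  refine HasDefect.of_bounded hM fun j => (norm_sub_le _ _).trans (add_le_add ?_ (hw _))
  have h1 : ‖R‖ ≤ M := by simpa using hM 1
  exact (R.le_opNorm _).trans (mul_le_mul h1 (hw j) (norm_nonneg _) ((norm_nonneg _).trans h1))

/-- The coherence error of `F` at `j` is that of `a` at `j` plus `l` times that of `F` at `j + 1`,
and shifting does not raise the defect rate. -/
theorem IsCoherent.of_forward (hR : IsPositiveOperator R) {M C l : ℝ}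
    (hM : ∀ n : ℕ, ‖R ^ n‖ ≤ M) (hl0 : 0 ≤ l) (hl : l < 1) {a F : ℕ → E} (ha : IsCoherent R a)
    (hF : ∀ j, ‖F j‖ ≤ C) (h : ∀ j, F j = a j + l • F (j + 1)) : IsCoherent R F := by
  refine ⟨⟨C, hF⟩, nullDefect_of_contraction hl0 hl (hasDefect_of_norm_le hM hF) ?_⟩
  intro d ε hε hd
  have h1 := ((hd.shift hR).smul l).add hR (ha.null ε hε)
  rw [abs_of_nonneg hl0] at h1
  convert h1 using 2 with j
  have e1 : R (F j) = R (a j) + l • R (F (j + 1)) := by rw [h j, map_add, map_smul]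
  linear_combination (norm := module) e1 - h (j + 1)

theorem IsCoherent.of_backward (hR : IsPositiveOperator R) {M C l : ℝ}
    (hM : ∀ n : ℕ, ‖R ^ n‖ ≤ M) (hl0 : 0 ≤ l) (hl : l < 1) {a B : ℕ → E} (ha : IsCoherent R a)
    (hB : ∀ j, ‖B j‖ ≤ C) (h : ∀ j, B (j + 1) = a j + l • B j) : IsCoherent R B := by
  refine ⟨⟨C, hB⟩, nullDefect_of_contraction hl0 hl (hasDefect_of_norm_le hM hB) ?_⟩
  intro d ε hε hd
  have h1 := (hd.smul l).add hR (ha.null ε hε)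
  rw [abs_of_nonneg hl0] at h1
  -- The recursion expresses the error of `B` only from index `1` on.
  refine HasDefect.of_shift hM ?_
  convert h1 using 2 with j
  rw [h (j + 1), h j, map_add, map_smul]
  module

theorem IsCoherent.null_pow (hR : IsPositiveOperator R) {M : ℝ} (hM : ∀ n : ℕ, ‖R ^ n‖ ≤ M)
    {w : ℕ → E} (hw : IsCoherent R w) (m : ℕ) :
    NullDefect R (fun j => (R ^ m) (w j) - w (j + m)) := by
  induction m with
  | zero =>
    intro ε hε
    refine ⟨0, fun n => ?_⟩
    have : defectSum R (fun j => (R ^ 0) (w j) - w (j + 0)) n = 0 := by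
      induction n with
      | zero => rfl
      | succ n ih => simp only [defectSum, ih]; simp
    rw [this]; simp; positivity
  | succ m ih =>
    have := (ih.map hR hM).add hR (hw.null.shift_add hR m)
    convert this using 2 with j
    rw [map_sub, pow_succ']
    simp [add_assoc]

/-- Norm continuity of the powers bounds the increments of coherent sequences. -/
theorem IsCoherent.hasDefect_increment (hR : IsPositiveOperator R) {M W ω ε : ℝ}
    (hM : ∀ n : ℕ, ‖R ^ n‖ ≤ M) {w : ℕ → E} (hw : IsCoherent R w) (hW : ∀ j, ‖w j‖ ≤ W) {m : ℕ}
    (hm : ‖R ^ (m + 1) - R ^ m‖ ≤ ω) (hε : 0 < ε) :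
    HasDefect R (fun j => w (j + 1) - w j) (M * (ω * W) + ε) := by
  have h1 : HasDefect R (fun j => (R ^ (m + 1) - R ^ m) (w j)) (M * (ω * W)) :=
    HasDefect.of_bounded hM fun j => ((R ^ (m + 1) - R ^ m).le_opNorm _).trans
      (mul_le_mul hm (hW j) (norm_nonneg _) ((norm_nonneg _).trans hm))
  have h2 := (hw.null_pow hR hM m).add hR ((hw.null_pow hR hM (m + 1)).smul (-1))
  -- Up to null defect, `w (j + m + 1) - w (j + m)` is `(R ^ (m + 1) - R ^ m) (w j)`; the first `m`
  -- increments affect only the constant.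
  refine HasDefect.of_shift_add hM m ?_
  convert h1.add hR (h2 ε hε) using 2 with j
  rw [_root_.sub_apply, show j + (m + 1) = j + m + 1 by ring]
  module

end Defect

/-! ### Slowly varying weights and the quantitative increment bound. -/

section SlowWeight

variable {E : Type*} [NormedAddCommGroup E] [NormedSpace ℝ E] [Lattice E] [IsOrderedAddMonoid E]
  [IsOrderedModule ℝ E] [HasSolidNorm E]

theorem exists_forward_sum [CompleteSpace E] {a : ℕ → E} {A l : ℝ} (hl0 : 0 ≤ l) (hl : l < 1)
    (ha : ∀ j, ‖a j‖ ≤ A) :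
    ∃ F : ℕ → E, (∀ j, F j = a j + l • F (j + 1)) ∧ ∀ j, ‖F j‖ ≤ A / (1 - l) := by
  have hbound : ∀ j i : ℕ, ‖l ^ i • a (j + i)‖ ≤ A * l ^ i := by
    intro j i
    rw [norm_smul, Real.norm_eq_abs, abs_of_nonneg (pow_nonneg hl0 i), mul_comm]
    exact mul_le_mul_of_nonneg_right (ha _) (pow_nonneg hl0 i)
  have hgeo : HasSum (fun i : ℕ => A * l ^ i) (A / (1 - l)) := by
    rw [div_eq_mul_inv]
    exact (hasSum_geometric_of_lt_one hl0 hl).mul_left A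
  have hsum : ∀ j, Summable fun i : ℕ => l ^ i • a (j + i) := fun j =>
    Summable.of_norm_bounded hgeo.summable (hbound j)
  refine ⟨fun j => ∑' i : ℕ, l ^ i • a (j + i), fun j => ?_, fun j =>
    tsum_of_norm_bounded hgeo (hbound j)⟩
  change ∑' i : ℕ, l ^ i • a (j + i) = a j + l • ∑' i : ℕ, l ^ i • a (j + 1 + i)
  rw [(hsum j).tsum_eq_zero_add, ← tsum_const_smul'' l]
  congr 1
  · simp
  · refine tsum_congr fun i => ?_
    rw [smul_smul, ← pow_succ', show j + (i + 1) = j + 1 + i by ring]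

/-- Iterating the difference of the two recursions bounds `F j - |X j|` below by `l ^ k • (F (j + k)
- |X (j + k)|)`, which tends to zero by boundedness. -/
theorem abs_le_of_forward {a F X : ℕ → E} {l C D : ℝ} (hl0 : 0 ≤ l) (hl : l < 1)
    (hF : ∀ j, F j = a j + l • F (j + 1)) (hFC : ∀ j, ‖F j‖ ≤ C) (hX : ∀ j, ‖X j‖ ≤ D)
    (h : ∀ j, |X j| ≤ a j + l • |X (j + 1)|) (j : ℕ) : |X j| ≤ F j := by
  have h1 : ∀ k : ℕ, l ^ k • (F (j + k) - |X (j + k)|) ≤ F j - |X j| := by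
    intro k
    induction k with
    | zero => simp
    | succ k ih =>
      refine le_trans ?_ ih
      rw [pow_succ, mul_smul]
      refine smul_le_smul_of_nonneg_left ?_ (pow_nonneg hl0 k)
      have h2 := h (j + k)
      rw [hF (j + k), smul_sub]
      rw [← sub_nonneg] at h2 ⊢
      refine h2.trans (le_of_eq ?_)
      rw [add_assoc j k 1]
      abel
  have h2 : Tendsto (fun k : ℕ => l ^ k • (F (j + k) - |X (j + k)|)) atTop (𝓝 0) := by
    refine squeeze_zero_norm (a := fun k => l ^ k * (C + D)) (fun k => ?_) ?_
    · rw [norm_smul, Real.norm_eq_abs, abs_of_nonneg (pow_nonneg hl0 k)]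
      refine mul_le_mul_of_nonneg_left ?_ (pow_nonneg hl0 k)
      refine (norm_sub_le _ _).trans (add_le_add (hFC _) ?_)
      rw [norm_abs_eq_norm]; exact hX _
    · have := (tendsto_pow_atTop_nhds_zero_of_lt_one hl0 hl).mul_const (C + D)
      rwa [zero_mul] at this
  exact sub_nonneg.1 (le_of_tendsto' h2 h1)

theorem exists_backward_sum {a : ℕ → E} {A l : ℝ} (hl0 : 0 ≤ l) (hl : l < 1)
    (ha : ∀ j, ‖a j‖ ≤ A) (ha0 : ∀ j, 0 ≤ a j) :
    ∃ B : ℕ → E, (∀ j, B (j + 1) = l • a j + l • B j) ∧ (∀ j, ‖B j‖ ≤ A / (1 - l)) ∧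
      ∀ j, 0 ≤ B j := by
  refine ⟨fun j => Nat.rec 0 (fun j b => l • a j + l • b) j, fun j => rfl, fun j => ?_, fun j => ?_⟩
  · have hA : 0 ≤ A := (norm_nonneg _).trans (ha 0)
    have h1 : 0 < 1 - l := by linarith
    induction j with
    | zero =>
      change ‖(0 : E)‖ ≤ _
      rw [norm_zero]; positivity
    | succ j ih =>
      refine (norm_add_le _ _).trans ?_
      rw [norm_smul, norm_smul, Real.norm_eq_abs, abs_of_nonneg hl0]
      have h2 := mul_le_mul_of_nonneg_left (ha j) hl0
      have h3 := mul_le_mul_of_nonneg_left ih hl0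
      refine (add_le_add h2 h3).trans ?_
      have h4 : A / (1 - l) - l * (A / (1 - l)) = A := by field_simp
      nlinarith
  · induction j with
    | zero => exact le_rfl
    | succ j ih => exact add_nonneg (smul_nonneg hl0 (ha0 j)) (smul_nonneg hl0 ih)

variable {R : E →L[ℝ] E}

/-- A slowly varying coherent weight dominating two given coherent sequences. -/
theorem exists_slow_weight [CompleteSpace E] (hR : IsPositiveOperator R) {M s κ V : ℝ}
    (hM : ∀ n : ℕ, ‖R ^ n‖ ≤ M) (hs : 0 < s) (hs1 : s ≤ 1) (hκ : 0 < κ) (hκ1 : κ ≤ 1)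
    {x y z : ℕ → E} (hx : IsCoherent R x) (hy : IsCoherent R y) (hz : IsCoherent R z)
    (hxV : ∀ j, ‖x j‖ ≤ V) (hyV : ∀ j, ‖y j‖ ≤ V) (hzV : ∀ j, ‖z j‖ ≤ V)
    (hxy : ∀ j, x (j + 1) - x j = s • y j) (hyz : ∀ j, y (j + 1) - y j = s • z j) :
    ∃ u : ℕ → E, IsCoherent R u ∧ (∀ j, ‖u j‖ ≤ 16 * V / κ) ∧ (∀ j, |x j| ≤ u j) ∧
      (∀ j, |y j| ≤ u j) ∧ (∀ j, u (j + 1) ≤ (1 + κ * s) • u j) ∧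
      ∀ j, u j ≤ (1 + κ * s) • u (j + 1) := by
  have hV : 0 ≤ V := (norm_nonneg _).trans (hxV 0)
  have hδ : 0 < κ * s := by positivity
  -- The weight is `F + B`, a two-sided discounted sum of `a` with ratio `l`, so neighbouring values
  -- differ by a factor of at most `l⁻¹ = 1 + κ * s`.
  set l : ℝ := (1 + κ * s)⁻¹ with hl
  have hl0 : 0 < l := by positivity
  have hl1 : l < 1 := inv_lt_one_of_one_lt₀ (by linarith)
  have hll : l * (1 + κ * s) = 1 := inv_mul_cancel₀ (by positivity)
  -- Dominating `x` needs `|x| + |y|` and dominating `y` needs `|y| + |z|`. The factor `s` offsets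
  -- `1 / (1 - l)`, which is of order `1 / (κ * s)`.
  set a : ℕ → E := fun j => s • ((|x j| + (2 : ℝ) • |y j|) + |z j|) with ha
  have hac : IsCoherent R a :=
    ((((hx.abs hR hM).add hR ((hy.abs hR hM).smul 2))).add hR (hz.abs hR hM)).smul s
  have haA : ∀ j, ‖a j‖ ≤ s * (4 * V) := by
    intro j
    rw [ha, norm_smul, Real.norm_eq_abs, abs_of_pos hs]
    refine mul_le_mul_of_nonneg_left ?_ hs.le
    refine (norm_add₃_le).trans ?_
    rw [norm_smul, norm_abs_eq_norm, norm_abs_eq_norm, norm_abs_eq_norm]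
    norm_num
    linarith [hxV j, hyV j, hzV j]
  have ha0 : ∀ j, 0 ≤ a j := fun j => smul_nonneg hs.le (add_nonneg (add_nonneg (abs_nonneg _)
    (smul_nonneg zero_le_two (abs_nonneg _))) (abs_nonneg _))
  obtain ⟨F, hF, hFA⟩ := exists_forward_sum hl0.le hl1 haA
  obtain ⟨B, hB, hBA, hB0⟩ := exists_backward_sum hl0.le hl1 haA ha0
  have hA : s * (4 * V) / (1 - l) ≤ 8 * V / κ := by
    rw [div_le_div_iff₀ (by linarith) hκ]
    have h1 : 1 - l = l * (κ * s) := by linarith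
    have h2 : 1 ≤ 2 * l := by
      have : κ * s ≤ 1 := mul_le_one₀ hκ1 hs.le hs1
      nlinarith
    rw [h1]
    have : 0 ≤ V * (κ * s) := by positivity
    nlinarith
  have hdom : ∀ {X Y : ℕ → E}, (∀ j, ‖X j‖ ≤ V) → (∀ j, X (j + 1) - X j = s • Y j) →
      (∀ j, s • (|X j| + |Y j|) ≤ a j) → ∀ j, |X j| ≤ F j := by
    intro X Y hX hXY hXa
    refine abs_le_of_forward hl0.le hl1 hF hFA hX fun j => ?_
    refine le_trans ?_ (add_le_add_left (hXa j) _)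
    -- Split `|X j|` with weights `1 - l` and `l`: as `1 - l ≤ s`, the first part is at most `s • |X
    -- j|`, and the second is moved to `j + 1` at the cost of `s • |Y j|`.
    have h1 : |X j| ≤ |X (j + 1)| + s • |Y j| := by
      have h2 := abs_add_le (X (j + 1)) (-(s • Y j))
      rw [abs_neg, ← hXY j, ← sub_eq_add_neg, sub_sub_cancel, hXY j, lattice_abs_smul,
        abs_of_pos hs] at h2
      exact h2
    have h2 := smul_le_smul_of_nonneg_left h1 hl0.le
    have h3 : (1 - l) • |X j| ≤ s • |X j| := by
      refine smul_le_smul_of_nonneg_right ?_ (abs_nonneg _)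
      nlinarith
    have h4 : l • (s • |Y j|) ≤ (1 : ℝ) • (s • |Y j|) :=
      smul_le_smul_of_nonneg_right hl1.le (smul_nonneg hs.le (abs_nonneg _))
    have h5 := add_le_add (add_le_add h2 h3) h4
    rw [← sub_nonneg] at h5 ⊢
    refine h5.trans (le_of_eq ?_)
    module
  have hxF : ∀ j, |x j| ≤ F j := hdom hxV hxy fun j => by
    refine smul_le_smul_of_nonneg_left ?_ hs.le
    rw [add_assoc]
    refine add_le_add le_rfl ?_
    rw [two_smul, add_assoc]
    exact le_add_of_nonneg_right (add_nonneg (abs_nonneg _) (abs_nonneg _))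
  have hyF : ∀ j, |y j| ≤ F j := hdom hyV hyz fun j => by
    refine smul_le_smul_of_nonneg_left ?_ hs.le
    refine add_le_add ?_ le_rfl
    rw [two_smul, ← add_assoc]
    exact le_add_of_nonneg_left (add_nonneg (abs_nonneg _) (abs_nonneg _))
  have hFu : ∀ j, F j ≤ F j + B j := fun j => le_add_of_nonneg_right (hB0 j)
  have hl2 : 0 ≤ 1 - l * l := by nlinarith
  refine ⟨fun j => F j + B j, (hac.of_forward hR hM hl0.le hl1 hFA hF).add hR
    ((hac.smul l).of_backward hR hM hl0.le hl1 hBA hB), fun j => ?_, fun j => (hxF j).trans (hFu j),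
    fun j => (hyF j).trans (hFu j), fun j => ?_, fun j => ?_⟩
  · refine (norm_add_le _ _).trans ((add_le_add (hFA j) (hBA j)).trans ?_)
    rw [show 16 * V / κ = 8 * V / κ + 8 * V / κ by ring]
    exact add_le_add hA hA
  · have h1 : l • (F (j + 1) + B (j + 1)) ≤ F j + B j := by
      rw [hB j, hF j, ← sub_nonneg]
      refine (smul_nonneg hl2 (add_nonneg (ha0 j) (hB0 j))).trans (le_of_eq ?_)
      module
    have h2 := smul_le_smul_of_nonneg_left h1 (show 0 ≤ 1 + κ * s by positivity)
    rwa [smul_smul, mul_comm _ l, hll, one_smul] at h2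
  · have h1 : l • (F j + B j) ≤ F (j + 1) + B (j + 1) := by
      rw [hB j, hF j, ← sub_nonneg]
      have hF1 : 0 ≤ F (j + 1) := (abs_nonneg _).trans (hxF (j + 1))
      refine (smul_nonneg hl2 hF1).trans (le_of_eq ?_)
      module
    have h2 := smul_le_smul_of_nonneg_left h1 (show 0 ≤ 1 + κ * s by positivity)
    rwa [smul_smul, mul_comm _ l, hll, one_smul] at h2

theorem isCoherent_orbit {M : ℝ} (hM : ∀ n : ℕ, ‖R ^ n‖ ≤ M) (f : E) :
    IsCoherent R (fun j => (R ^ j) f) := by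
  refine ⟨⟨M * ‖f‖, fun j => ((R ^ j).le_opNorm f).trans
    (mul_le_mul_of_nonneg_right (hM j) (norm_nonneg _))⟩, fun ε hε => ⟨0, fun n => ?_⟩⟩
  have : defectSum R (fun j => R ((R ^ j) f) - (R ^ (j + 1)) f) n = 0 := by
    induction n with
    | zero => rfl
    | succ n ih =>
      simp only [defectSum, ih]
      rw [pow_succ']
      simp
  rw [this, norm_zero]
  positivity

theorem HasDefect.telescope (hR : IsPositiveOperator R) {x : ℕ → E} {c : ℝ}
    (h : HasDefect R (fun j => x (j + 1) - x j) c) (K : ℕ) :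
    HasDefect R (fun j => x (j + K) - x j) (K * c) := by
  induction K with
  | zero =>
    refine ⟨0, fun n => ?_⟩
    have : defectSum R (fun j => x (j + 0) - x j) n = 0 := by
      induction n with
      | zero => rfl
      | succ n ih => simp only [defectSum, ih]; simp
    rw [this]; simp
  | succ K ih =>
    convert ih.add hR (h.shift_add hR K) using 2 with j
    · rw [show j + (K + 1) = j + K + 1 by ring]; abel
    · push_cast; ring

/-- Each transported term `(R ^ (n - j)) |(R ^ j) f|` dominates `|(R ^ n) f|`, so along an orbit
nothing is lost. This turns a defect bound back into a norm bound. -/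
theorem norm_le_of_hasDefect_orbit (hR : IsPositiveOperator R) {f : E} {c c₀ : ℝ}
    (h : HasDefect R (fun j => (R ^ j) f) c) (hc₀ : ∀ n : ℕ, c₀ ≤ ‖(R ^ n) f‖) : c₀ ≤ c := by
  obtain ⟨C, hC⟩ := h
  have h1 : ∀ n : ℕ, ((n : ℝ) + 1) • |(R ^ n) f| ≤ defectSum R (fun j => (R ^ j) f) (n + 1) := by
    intro n
    induction n with
    | zero => simp [defectSum]
    | succ n ih =>
      have h2 := hR.mono ih
      rw [map_smul] at h2
      have h3 : |(R ^ (n + 1)) f| ≤ R |(R ^ n) f| := by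
        rw [pow_succ']; exact hR.abs_apply_le _
      have h4 := smul_le_smul_of_nonneg_left h3 (show (0 : ℝ) ≤ (n : ℝ) + 1 by positivity)
      have h5 := add_le_add (h4.trans h2) (le_refl |(R ^ (n + 1)) f|)
      refine le_trans (le_of_eq ?_) h5
      rw [Nat.cast_succ]
      module
  have h2 : ∀ n : ℕ, ((n : ℝ) + 1) * c₀ ≤ c * ((n : ℝ) + 1) + C := by
    intro n
    have h3 := (norm_le_of_nonneg_of_le (smul_nonneg (by positivity) (abs_nonneg _)) (h1 n)).trans
      (hC (n + 1))
    rw [norm_smul, Real.norm_eq_abs, abs_of_nonneg (by positivity), norm_abs_eq_norm,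
      Nat.cast_succ] at h3
    exact (mul_le_mul_of_nonneg_left (hc₀ n) (by positivity)).trans h3
  by_contra hlt
  push Not at hlt
  obtain ⟨n, hn⟩ := exists_nat_gt (C / (c₀ - c))
  rw [div_lt_iff₀ (by linarith)] at hn
  have := h2 n
  nlinarith

/-- A quantitative lower bound for the decay of `R ^ n (R ^ K - 1) f`. -/
theorem orbit_increment_bound [CompleteSpace E] (hR : IsPositiveOperator R)
    {M s κ V ω c₀ : ℝ} (hM : ∀ n : ℕ, ‖R ^ n‖ ≤ M) (hs : 0 < s) (hs1 : s ≤ 1) (hκ : 0 < κ)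
    (hκ1 : κ ≤ 1 / 2) {f y z : E} (hf : ‖f‖ ≤ V) (hy : ‖y‖ ≤ V) (hz : ‖z‖ ≤ V)
    (hfy : R f - f = s • y) (hyz : R y - y = s • z) {m K : ℕ}
    (hm : ‖R ^ (m + 1) - R ^ m‖ ≤ ω) (hc₀ : ∀ n : ℕ, c₀ ≤ ‖(R ^ n) ((R ^ K) f - f)‖) :
    c₀ ≤ K * s * (128 * M ^ 2 * ω * V / κ + κ * M ^ 2 * V + 128 * s * M ^ 2 * V) := by
  have hM0 : 0 ≤ M := (norm_nonneg _).trans (hM 0)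
  have hV : 0 ≤ V := (norm_nonneg _).trans hf
  have hω : 0 ≤ ω := (norm_nonneg _).trans hm
  have horb : ∀ {g : E}, ‖g‖ ≤ V → ∀ j : ℕ, ‖(R ^ j) g‖ ≤ M * V := fun {g} hg j =>
    ((R ^ j).le_opNorm g).trans (mul_le_mul (hM j) hg (norm_nonneg _) hM0)
  have hstep : ∀ {g k : E}, R g - g = s • k →
      ∀ j : ℕ, (R ^ (j + 1)) g - (R ^ j) g = s • (R ^ j) k := by
    intro g k hgk j
    rw [← map_smul, ← hgk, map_sub, pow_succ]; rfl
  obtain ⟨u, hu, huU, hxu, hyu, hu1, hu2⟩ := exists_slow_weight hR hM hs hs1 hκ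
    (by linarith) (isCoherent_orbit hM f) (isCoherent_orbit hM y) (isCoherent_orbit hM z)
    (horb hf) (horb hy) (horb hz) (hstep hfy) (hstep hyz)
  set U := 16 * (M * V) / κ with hU
  have hU0 : 0 ≤ U := by positivity
  -- With `N` periods the range `(1 + 2 * s) • u` is covered, so for both phases the truncated wave
  -- is the full one.
  obtain ⟨N, hN⟩ := exists_nat_gt ((1 + 2 * s) / (8 * s))
  rw [div_lt_iff₀ (by positivity)] at hN
  have hu0 : ∀ j, 0 ≤ u j := fun j => (abs_nonneg _).trans (hxu j)
  have hwave : ∀ {w : ℕ → E}, (∀ j, |w j| ≤ (1 + 2 * s) • u j) → ∀ j,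
      ‖wave (w j) ((8 * s) • u j) N‖ ≤ 4 * s * U := by
    intro w hw j
    have h1 : wave (w j) ((8 * s) • u j) N ≤ (2⁻¹ : ℝ) • ((8 * s) • u j) := by
      refine wave_le_half (smul_nonneg (by positivity) (hu0 j)) ((hw j).trans ?_)
      rw [smul_smul]
      exact smul_le_smul_of_nonneg_right hN.le (hu0 j)
    refine (norm_le_of_nonneg_of_le (wave_nonneg _ _ _) h1).trans ?_
    rw [smul_smul, norm_smul, Real.norm_eq_abs, abs_of_pos (by positivity)]
    have := huU j
    nlinarith
  have hw1 : ∀ j, |(R ^ j) f| ≤ (1 + 2 * s) • u j := fun j => (hxu j).trans (by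
    rw [add_smul, one_smul]
    exact le_add_of_nonneg_right (smul_nonneg (by positivity) (hu0 j)))
  have hw2 : ∀ j, |(R ^ j) f + (2 * s) • u j| ≤ (1 + 2 * s) • u j := fun j => by
    refine (abs_add_le _ _).trans ?_
    rw [lattice_abs_smul, abs_of_nonneg (hu0 j), abs_of_pos (show 0 < 2 * s by positivity),
      add_smul, one_smul]
    exact add_le_add (hxu j) le_rfl
  -- By `wave_ineq` with `δ = κ * s`, one increment is controlled by the four defects `d1` to `d4`,
  -- the first two being `ω` times the amplitude `4 * s * U`. Telescoping over `K` steps gives the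
  -- factor `K`.
  have key : ∀ ε : ℝ, 0 < ε → c₀ ≤ K * ((((M * (ω * (4 * s * U)) + ε) +
      (M * (ω * (4 * s * U)) + ε)) + |κ * s| * (M * (M * V))) +
      |8 * s * (κ * s)| * (M * U)) := by
    intro ε hε
    have d1 := ((isCoherent_orbit hM f).wave hR hM (hu.smul (8 * s)) N).hasDefect_increment hR hM
      (hwave hw1) hm hε
    have d2 := (((isCoherent_orbit hM f).add hR (hu.smul (2 * s))).wave hR hM
      (hu.smul (8 * s)) N).hasDefect_increment hR hM (hwave hw2) hm hε
    have d3 := (HasDefect.of_bounded hM fun j => horb hf (j + 1)).smul (κ * s)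
    have d4 := (HasDefect.of_bounded hM fun j => huU (j + 1)).smul (8 * s * (κ * s))
    have dabs : ∀ {G : ℕ → E} {c : ℝ}, HasDefect R G c → HasDefect R (fun j => |G j|) c :=
      fun h => h.of_le hR fun j => by rw [abs_abs]
    have d3' : HasDefect R (fun j => (κ * s) • |(R ^ (j + 1)) f|) (|κ * s| * (M * (M * V))) :=
      d3.of_le hR fun j => by rw [lattice_abs_smul, lattice_abs_smul, abs_abs]
    have d5 := (((dabs d1).add hR (dabs d2)).add hR d3').add hR d4
    have d6 : HasDefect R (fun j => (R ^ (j + 1)) f - (R ^ j) f) _ := d5.of_le hR fun j => by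
      refine (wave_ineq (n := N) hs (show 0 ≤ κ * s by positivity) (by nlinarith) (by nlinarith)
        (hxu j) (hxu (j + 1)) ?_ (hu1 j) (hu2 j) hN.le).trans (le_abs_self _)
      rw [hstep hfy j, lattice_abs_smul, abs_of_pos hs]
      exact smul_le_smul_of_nonneg_left (hyu j) hs.le
    have d7 := HasDefect.telescope hR (x := fun j => (R ^ j) f) d6 K
    refine norm_le_of_hasDefect_orbit hR (f := (R ^ K) f - f) ?_ hc₀
    convert d7 using 2 with j
    rw [map_sub, pow_add]; rfl
  refine le_of_forall_pos_le_add fun η hη => ?_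
  refine (key (η / (2 * (K + 1))) (by positivity)).trans ?_
  rw [abs_of_pos (show 0 < κ * s by positivity), abs_of_pos (show 0 < 8 * s * (κ * s) by positivity)]
  have h1 : (K : ℝ) * (η / (2 * (K + 1)) + η / (2 * (K + 1))) ≤ η := by
    rw [← add_div, mul_div_assoc', div_le_iff₀ (by positivity)]
    nlinarith
  -- As `U` carries the factor `16`, the constants are `2 * 4 * 16` and `8 * 16`.
  have h2 : (K : ℝ) * s * (128 * M ^ 2 * ω * V / κ + κ * M ^ 2 * V + 128 * s * M ^ 2 * V) =
      K * (2 * (M * (ω * (4 * s * U))) + κ * s * (M * (M * V)) + 8 * s * (κ * s) * (M * U)) := by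
    rw [hU]; field_simp; ring
  rw [h2]
  linarith

end SlowWeight

namespace BanachLatticeSemigroup

/-! ### Orbits of a bounded semigroup and their integrals. -/

section Semigroup

variable {E : Type*} [NormedAddCommGroup E] [NormedSpace ℝ E] {S : ℝ → E →L[ℝ] E}

/-- The orbit of `f`, extended by the value `f` to the half line `(-∞, 0]`. -/
noncomputable def orbit (S : ℝ → E →L[ℝ] E) (f : E) (t : ℝ) : E := if 0 < t then S t f else f

theorem orbit_of_pos (S : ℝ → E →L[ℝ] E) (f : E) {t : ℝ} (ht : 0 < t) : orbit S f t = S t f :=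
  if_pos ht

theorem orbit_of_nonpos (S : ℝ → E →L[ℝ] E) (f : E) {t : ℝ} (ht : t ≤ 0) : orbit S f t = f :=
  if_neg ht.not_gt

theorem orbit_sub (S : ℝ → E →L[ℝ] E) (f g : E) (t : ℝ) :
    orbit S (f - g) t = orbit S f t - orbit S g t := by
  unfold orbit; split_ifs <;> simp

theorem IsSemigroup.apply_add (h : IsSemigroup S) {s t : ℝ} (hs : 0 < s) (ht : 0 < t) (f : E) :
    S (s + t) f = S s (S t f) := by
  rw [add_comm, h.add t s ht hs]; rfl

theorem IsSemigroup.apply_comm (h : IsSemigroup S) {s t : ℝ} (hs : 0 < s) (ht : 0 < t) (f : E) :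
    S s (S t f) = S t (S s f) := by
  rw [← h.apply_add hs ht, ← h.apply_add ht hs, add_comm]

theorem map_orbit (h : IsSemigroup S) {s : ℝ} (hs : 0 < s) (f : E) {t : ℝ} (ht : 0 ≤ t) :
    S s (orbit S f t) = orbit S f (s + t) := by
  rcases ht.eq_or_lt with ht | ht
  · rw [← ht, orbit_of_nonpos S f le_rfl, add_zero, orbit_of_pos S f hs]
  · rw [orbit_of_pos S f ht, orbit_of_pos S f (by linarith), h.apply_add hs ht]

theorem orbit_map (h : IsSemigroup S) {s : ℝ} (hs : 0 < s) (f : E) {t : ℝ} (ht : 0 ≤ t) :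
    orbit S (S s f) t = orbit S f (s + t) := by
  rcases ht.eq_or_lt with ht | ht
  · rw [← ht, orbit_of_nonpos S _ le_rfl, add_zero, orbit_of_pos S f hs]
  · rw [orbit_of_pos S _ ht, orbit_of_pos S f (by linarith), h.apply_add hs ht,
      h.apply_comm hs ht]

/-- A common bound `M ≥ 1` of all operators of the semigroup. -/
def IsSemigroupBound (S : ℝ → E →L[ℝ] E) (M : ℝ) : Prop := 1 ≤ M ∧ ∀ t : ℝ, 0 < t → ‖S t‖ ≤ M

theorem exists_isSemigroupBound (h : IsBoundedSemigroup S) : ∃ M, IsSemigroupBound S M := by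
  obtain ⟨M, hM⟩ := h
  exact ⟨max M 1, le_max_right _ _, fun t ht => (hM t ht).trans (le_max_left _ _)⟩

theorem IsSemigroupBound.norm_apply_le {M : ℝ} (hM : IsSemigroupBound S M) {t : ℝ} (ht : 0 < t)
    (f : E) : ‖S t f‖ ≤ M * ‖f‖ :=
  ((S t).le_opNorm f).trans (mul_le_mul_of_nonneg_right (hM.2 t ht) (norm_nonneg f))

theorem IsSemigroupBound.norm_orbit_le {M : ℝ} (hM : IsSemigroupBound S M) (t : ℝ)
    (f : E) : ‖orbit S f t‖ ≤ M * ‖f‖ := by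
  unfold orbit
  split_ifs with ht
  · exact hM.norm_apply_le ht f
  · exact le_mul_of_one_le_left (norm_nonneg f) hM.1

theorem tendsto_orbit_zero (h : IsC0Semigroup S) (f : E) :
    Tendsto (orbit S f) (𝓝 0) (𝓝 f) := by
  rw [← nhdsLE_sup_nhdsGT, tendsto_sup]
  constructor
  · refine tendsto_const_nhds.congr' ?_
    filter_upwards [self_mem_nhdsWithin] with t ht
    exact (orbit_of_nonpos S f ht).symm
  · refine (h.tendsto_zero f).congr' ?_
    filter_upwards [self_mem_nhdsWithin] with t ht
    exact (orbit_of_pos S f ht).symm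

theorem continuous_orbit (h : IsC0Semigroup S) {M : ℝ} (hM : IsSemigroupBound S M) (f : E) :
    Continuous (orbit S f) := by
  have key : ∀ a b : ℝ, 0 ≤ a → a ≤ b →
      ‖orbit S f b - orbit S f a‖ ≤ M * ‖orbit S f (b - a) - f‖ := by
    intro a b ha hab
    rcases ha.eq_or_lt with ha | ha
    · rw [← ha, sub_zero, orbit_of_nonpos S f le_rfl]
      exact le_mul_of_one_le_left (norm_nonneg _) hM.1
    · have h1 : orbit S f b - orbit S f a = S a (orbit S f (b - a) - f) := by
        rw [map_sub, map_orbit h.toIsSemigroup ha f (by linarith), orbit_of_pos S f ha,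
          add_sub_cancel]
      rw [h1]
      exact hM.norm_apply_le ha _
  -- The extended orbit is constant on the negative axis, so one symmetric estimate covers left and
  -- right continuity everywhere.
  have key' : ∀ a b : ℝ,
      ‖orbit S f b - orbit S f a‖ ≤ M * ‖orbit S f |max 0 b - max 0 a| - f‖ := by
    intro a b
    have hmax : ∀ t, orbit S f t = orbit S f (max 0 t) := by
      intro t
      rcases le_total t 0 with ht | ht
      · rw [max_eq_left ht, orbit_of_nonpos S f ht, orbit_of_nonpos S f le_rfl]
      · rw [max_eq_right ht]
    rw [hmax a, hmax b]
    rcases le_total (max 0 a) (max 0 b) with hab | hab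
    · rw [abs_of_nonneg (sub_nonneg.2 hab)]
      exact key _ _ (le_max_left _ _) hab
    · rw [abs_of_nonpos (sub_nonpos.2 hab), neg_sub, norm_sub_rev]
      exact key _ _ (le_max_left _ _) hab
  rw [continuous_iff_continuousAt]
  intro a
  rw [ContinuousAt, tendsto_iff_norm_sub_tendsto_zero]
  refine squeeze_zero (fun _ => norm_nonneg _) (key' a) ?_
  have h1 : Tendsto (fun b : ℝ => |max 0 b - max 0 a|) (𝓝 a) (𝓝 0) := by
    have : Continuous fun b : ℝ => |max 0 b - max 0 a| := by fun_prop
    simpa using this.tendsto a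
  have h2 := ((((tendsto_orbit_zero h f).comp h1).sub_const f).norm).const_mul M
  simpa using h2

variable [CompleteSpace E]

/-- The integral `∫₀ᵃ S(t) f dt`. -/
noncomputable def orbitIntegral (S : ℝ → E →L[ℝ] E) (a : ℝ) (f : E) : E :=
  ∫ t in (0 : ℝ)..a, orbit S f t

theorem orbitIntegral_sub (h : IsC0Semigroup S) {M : ℝ} (hM : IsSemigroupBound S M) (a : ℝ)
    (f g : E) : orbitIntegral S a (f - g) = orbitIntegral S a f - orbitIntegral S a g := by
  unfold orbitIntegral
  rw [← intervalIntegral.integral_sub ((continuous_orbit h hM f).intervalIntegrable _ _)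
    ((continuous_orbit h hM g).intervalIntegrable _ _)]
  simp only [orbit_sub]

theorem norm_orbitIntegral_le {M : ℝ} (hM : IsSemigroupBound S M) {a : ℝ} (ha : 0 ≤ a) (f : E) :
    ‖orbitIntegral S a f‖ ≤ a * (M * ‖f‖) := by
  have := intervalIntegral.norm_integral_le_of_norm_le_const (a := 0) (b := a)
    (f := orbit S f) (C := M * ‖f‖) fun t _ => hM.norm_orbit_le t f
  rw [sub_zero, abs_of_nonneg ha] at this
  unfold orbitIntegral
  linarith

theorem map_orbitIntegral (h : IsC0Semigroup S) {M : ℝ} (hM : IsSemigroupBound S M) {a s : ℝ}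
    (ha : 0 ≤ a) (hs : 0 < s) (f : E) :
    S s (orbitIntegral S a f) = orbitIntegral S a (S s f) := by
  unfold orbitIntegral
  rw [← (S s).intervalIntegral_comp_comm ((continuous_orbit h hM f).intervalIntegrable _ _)]
  refine intervalIntegral.integral_congr fun t ht => ?_
  rw [uIcc_of_le ha] at ht
  change S s (orbit S f t) = orbit S (S s f) t
  rw [map_orbit h.toIsSemigroup hs f ht.1, orbit_map h.toIsSemigroup hs f ht.1]

theorem orbitIntegral_map (h : IsC0Semigroup S) {a s : ℝ}
    (ha : 0 ≤ a) (hs : 0 < s) (f : E) :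
    orbitIntegral S a (S s f) = ∫ t in s..(s + a), orbit S f t := by
  unfold orbitIntegral
  have hshift := intervalIntegral.integral_comp_add_left (a := 0) (b := a) (orbit S f) s
  rw [add_zero] at hshift
  rw [← hshift]
  refine intervalIntegral.integral_congr fun t ht => ?_
  rw [uIcc_of_le ha] at ht
  exact orbit_map h.toIsSemigroup hs f ht.1

/-- Increments of the integrated orbit. -/
theorem map_orbitIntegral_sub (h : IsC0Semigroup S) {M : ℝ} (hM : IsSemigroupBound S M) {a s : ℝ}
    (ha : 0 < a) (hs : 0 < s) (f : E) :
    S s (orbitIntegral S a f) - orbitIntegral S a f = orbitIntegral S s (S a f - f) := by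
  have hi : ∀ b c : ℝ, IntervalIntegrable (orbit S f) MeasureTheory.volume b c :=
    fun b c => (continuous_orbit h hM f).intervalIntegrable b c
  rw [map_orbitIntegral h hM ha.le hs, orbitIntegral_map h ha.le hs, orbitIntegral_sub h hM,
    orbitIntegral_map h hs.le ha, add_comm a s]
  unfold orbitIntegral
  -- Both sides are the integral up to `s + a` minus those up to `s` and up to `a`.
  have h1 := intervalIntegral.integral_interval_sub_left (hi 0 (s + a)) (hi 0 s)
  have h2 := intervalIntegral.integral_interval_sub_left (hi 0 (s + a)) (hi 0 a)
  rw [← h1, ← h2]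
  abel

theorem tendsto_orbitIntegral (h : IsC0Semigroup S) {M : ℝ} (hM : IsSemigroupBound S M) (f : E) :
    Tendsto (fun a : ℝ => a⁻¹ • orbitIntegral S a f) (𝓝[>] 0) (𝓝 f) := by
  have h1 := intervalIntegral.integral_hasDerivAt_right
    ((continuous_orbit h hM f).intervalIntegrable 0 0)
    ((continuous_orbit h hM f).stronglyMeasurableAtFilter _ _)
    (continuous_orbit h hM f).continuousAt
  have h2 := h1.tendsto_slope_zero_right
  rw [orbit_of_nonpos S f le_rfl] at h2
  refine h2.congr fun a => ?_
  simp [orbitIntegral]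

end Semigroup

end BanachLatticeSemigroup

namespace BanachLatticeSemigroup

/-! ### Increments of orbits tend to zero. -/

section Convergence

variable {E : Type*} [NormedAddCommGroup E] [NormedSpace ℝ E] {S : ℝ → E →L[ℝ] E}

theorem IsSemigroup.pow_eq (h : IsSemigroup S) {s : ℝ} (hs : 0 < s) (n : ℕ) :
    (S s) ^ (n + 1) = S ((n + 1) * s) := by
  induction n with
  | zero => simp
  | succ n ih =>
    have h1 : 0 < ((n : ℝ) + 1) * s := by positivity
    rw [pow_succ, ih, show ((n + 1 : ℕ) + 1 : ℝ) * s = s + (n + 1) * s by push_cast; ring,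
      h.add s _ hs h1]
    rfl

theorem IsSemigroupBound.norm_pow_le (h : IsSemigroup S) {M : ℝ} (hM : IsSemigroupBound S M)
    {s : ℝ} (hs : 0 < s) (n : ℕ) : ‖(S s) ^ n‖ ≤ M := by
  cases n with
  | zero => rw [pow_zero]; exact (ContinuousLinearMap.norm_id_le).trans hM.1
  | succ n => rw [h.pow_eq hs]; exact hM.2 _ (by positivity)

/-- Eventual norm continuity gives small increments of the powers of `S s`. -/
theorem exists_norm_pow_sub_le (h : IsSemigroup S) {M : ℝ} (hM : IsSemigroupBound S M)
    (hcont : IsEventuallyNormContinuous S) {ω : ℝ} (hω : 0 < ω) :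
    ∃ s₀ : ℝ, 0 < s₀ ∧ ∀ s : ℝ, 0 < s → s < s₀ → ∃ m : ℕ,
      ‖(S s) ^ (m + 1) - (S s) ^ m‖ ≤ ω := by
  obtain ⟨t₀, ht₀, hS⟩ := hcont
  have hM0 : 0 < M := lt_of_lt_of_le one_pos hM.1
  set t₁ := t₀ + 1 with ht₁
  have hat : ContinuousAt S t₁ := hS.continuousAt (Ioi_mem_nhds (by linarith))
  obtain ⟨s₀, hs₀, hball⟩ := Metric.continuousAt_iff.1 hat (ω / M) (by positivity)
  refine ⟨s₀, hs₀, fun s hs hss => ⟨⌊t₁ / s⌋₊ + 1, ?_⟩⟩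
  set m := ⌊t₁ / s⌋₊
  have hms : t₁ < ((m : ℝ) + 1) * s := by
    have := Nat.lt_floor_add_one (t₁ / s)
    rwa [div_lt_iff₀ hs] at this
  have h1 := hball (x := t₁ + s) (by
    rw [Real.dist_eq, add_sub_cancel_left, abs_of_pos hs]; exact hss)
  rw [dist_eq_norm] at h1
  have hr : 0 < ((m : ℝ) + 1) * s - t₁ := by linarith
  -- Continuity at the single time `t₁` suffices: the remaining time `(m + 1) * s - t₁` is positive
  -- and costs only a factor `M`.
  have h2 : (S s) ^ (m + 1 + 1) - (S s) ^ (m + 1) =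
      (S (((m : ℝ) + 1) * s - t₁)).comp (S (t₁ + s) - S t₁) := by
    rw [h.pow_eq hs, h.pow_eq hs, ContinuousLinearMap.comp_sub, ← h.add _ _ (by linarith) hr,
      ← h.add _ _ (by linarith) hr]
    congr 2 <;> push_cast <;> ring
  rw [h2]
  refine (ContinuousLinearMap.opNorm_comp_le _ _).trans ?_
  refine (mul_le_mul (hM.2 _ hr) h1.le (norm_nonneg _) hM0.le).trans (le_of_eq ?_)
  field_simp

/-- An orbit that is small once stays small up to the factor `M`; one that does not tend to zero
therefore stays away from it at all times. -/
theorem exists_lower_bound_of_not_tendsto (h : IsSemigroup S) {M : ℝ}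
    (hM : IsSemigroupBound S M) {g : E} (hg : ¬ Tendsto (fun t => S t g) atTop (𝓝 0)) :
    ∃ c : ℝ, 0 < c ∧ c ≤ ‖g‖ ∧ ∀ t : ℝ, 0 < t → c ≤ ‖S t g‖ := by
  have hM0 : 0 < M := lt_of_lt_of_le one_pos hM.1
  rw [Metric.tendsto_atTop] at hg
  push Not at hg
  obtain ⟨ε, hε, hT⟩ := hg
  refine ⟨ε / M, by positivity, ?_, fun t ht => ?_⟩
  · obtain ⟨t, ht, h1⟩ := hT 1
    rw [dist_zero_right] at h1
    rw [div_le_iff₀ hM0, mul_comm]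
    exact h1.trans (hM.norm_apply_le (by linarith) g)
  · obtain ⟨t', ht', h1⟩ := hT (t + 1)
    rw [dist_zero_right] at h1
    rw [div_le_iff₀ hM0, mul_comm]
    have h2 : S t' g = S (t' - t) (S t g) := by
      rw [← h.apply_add (by linarith) ht, sub_add_cancel]
    rw [h2] at h1
    exact h1.trans (hM.norm_apply_le (by linarith) _)

variable [CompleteSpace E] [Lattice E] [IsOrderedAddMonoid E] [IsOrderedModule ℝ E]
  [HasSolidNorm E]

/-- The bounds on first and second differences give a `V` independent of `s`. With `s = a / K`,
`orbit_increment_bound` has three errors, governed by `ω / κ`, `κ` and `s`. Choosing `κ`, then `ω`,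
then `s` makes each at most `c / 4`, against the lower bound `c`. -/
theorem tendsto_increment_of_smooth (h : IsSemigroup S) {M : ℝ} (hM : IsSemigroupBound S M)
    (hpos : IsPositiveSemigroup S) (hcont : IsEventuallyNormContinuous S) {f : E} {L : ℝ}
    (h1 : ∀ s : ℝ, 0 < s → ‖S s f - f‖ ≤ s * L)
    (h2 : ∀ s : ℝ, 0 < s → ‖S s (S s f - f) - (S s f - f)‖ ≤ s ^ 2 * L) {a : ℝ} (ha : 0 < a) :
    Tendsto (fun t => S t (S a f - f)) atTop (𝓝 0) := by
  by_contra hcon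
  obtain ⟨c, hc, hc0, hct⟩ := exists_lower_bound_of_not_tendsto h hM hcon
  have hM0 : 0 < M := lt_of_lt_of_le one_pos hM.1
  have hL : 0 ≤ L := by
    have := (norm_nonneg _).trans (h1 1 one_pos); linarith
  set V := ‖f‖ + L + 1 with hV
  have hV0 : 0 < V := by positivity
  set κ := min (1 / 2) (c / (4 * (a * M ^ 2 * V))) with hκ
  have hκ0 : 0 < κ := lt_min (by norm_num) (by positivity)
  set ω := κ * c / (4 * (a * (128 * M ^ 2 * V))) with hω
  have hω0 : 0 < ω := by positivity
  obtain ⟨s₀, hs₀, hm⟩ := exists_norm_pow_sub_le h hM hcont hω0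
  set s₁ := min (min 1 (s₀ / 2)) (c / (4 * (a * (128 * M ^ 2 * V)))) with hs₁
  have hs₁0 : 0 < s₁ := lt_min (lt_min one_pos (by positivity)) (by positivity)
  obtain ⟨K, hK⟩ := exists_nat_gt (a / s₁)
  have hK0 : (0 : ℝ) < K := lt_trans (by positivity) hK
  set s := a / K with hs
  have hs0 : 0 < s := by positivity
  have hss₁ : s ≤ s₁ := by
    rw [hs, div_le_iff₀ hK0]
    rw [div_lt_iff₀ hs₁0] at hK
    linarith
  have hKs : (K : ℝ) * s = a := by rw [hs]; field_simp
  obtain ⟨m, hm⟩ := hm s hs0 (hss₁.trans_lt (lt_of_le_of_lt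
    ((min_le_left _ _).trans (min_le_right _ _)) (by linarith)))
  have hpow : S s ^ K = S a := by
    obtain ⟨k, rfl⟩ : ∃ k, K = k + 1 := Nat.exists_eq_succ_of_ne_zero (by
      rintro rfl; simp at hK0)
    rw [h.pow_eq hs0, ← hKs]; push_cast; rfl
  have hbound := orbit_increment_bound (R := S s) (hpos s hs0) (c₀ := c) (V := V)
    (hM.norm_pow_le h hs0) hs0 (hss₁.trans ((min_le_left _ _).trans (min_le_left _ _))) hκ0
    (min_le_left _ _) (f := f) (y := s⁻¹ • (S s f - f))
    (z := (s⁻¹ ^ 2) • (S s (S s f - f) - (S s f - f))) (by linarith [norm_nonneg f])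
    (by
      rw [norm_smul, Real.norm_eq_abs, abs_of_pos (by positivity), inv_mul_le_iff₀ hs0]
      refine (h1 s hs0).trans (mul_le_mul_of_nonneg_left ?_ hs0.le)
      linarith [norm_nonneg f])
    (by
      rw [norm_smul, Real.norm_eq_abs, abs_of_pos (by positivity), inv_pow,
        inv_mul_le_iff₀ (by positivity)]
      refine (h2 s hs0).trans (mul_le_mul_of_nonneg_left ?_ (by positivity))
      linarith [norm_nonneg f])
    (by rw [smul_smul, mul_inv_cancel₀ hs0.ne', one_smul])
    (by
      rw [map_smul, ← smul_sub, smul_smul]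
      congr 1; field_simp)
    (K := K) hm (fun n => by
      rw [hpow]
      cases n with
      | zero => simpa using hc0
      | succ n => rw [h.pow_eq hs0]; exact hct _ (by positivity))
  rw [hKs] at hbound
  have e1 : a * (128 * M ^ 2 * ω * V / κ) = c / 4 := by
    rw [hω]; field_simp
  have e2 : a * (κ * M ^ 2 * V) ≤ c / 4 := by
    have := min_le_right (1 / 2) (c / (4 * (a * M ^ 2 * V)))
    rw [← hκ, le_div_iff₀ (by positivity)] at this
    linarith
  have e3 : a * (128 * s * M ^ 2 * V) ≤ c / 4 := by
    have := hss₁.trans (min_le_right _ _)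
    rw [le_div_iff₀ (by positivity)] at this
    linarith
  have e4 : a * (128 * M ^ 2 * ω * V / κ + κ * M ^ 2 * V + 128 * s * M ^ 2 * V) =
      a * (128 * M ^ 2 * ω * V / κ) + a * (κ * M ^ 2 * V) + a * (128 * s * M ^ 2 * V) := by ring
  rw [e4] at hbound
  linarith

/-- The vectors whose orbits tend to zero form a closed subspace. -/
def stableSubspace (S : ℝ → E →L[ℝ] E) : Submodule ℝ E where
  carrier := {f | Tendsto (fun t => S t f) atTop (𝓝 0)}
  zero_mem' := by simp
  add_mem' := by
    intro f g hf hg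
    have := Tendsto.add hf hg
    simpa using this
  smul_mem' := by
    intro c f hf
    have := Tendsto.const_smul hf c
    simpa using this

theorem isClosed_stableSubspace {M : ℝ} (hM : IsSemigroupBound S M) :
    IsClosed (stableSubspace S : Set E) := by
  have hM0 : 0 < M := lt_of_lt_of_le one_pos hM.1
  rw [← isSeqClosed_iff_isClosed]
  intro x f hx hf
  change Tendsto (fun t => S t f) atTop (𝓝 0)
  rw [Metric.tendsto_atTop]
  intro ε hε
  obtain ⟨n, hn⟩ := (Metric.tendsto_atTop.1 hf (ε / (2 * M)) (by positivity))
  have h1 := hn n le_rfl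
  obtain ⟨T, hT⟩ := Metric.tendsto_atTop.1 (hx n) (ε / 2) (by positivity)
  refine ⟨max T 1, fun t ht => ?_⟩
  have ht1 : 0 < t := lt_of_lt_of_le one_pos ((le_max_right _ _).trans ht)
  have h2 := hT t ((le_max_left _ _).trans ht)
  rw [dist_zero_right] at h2 ⊢
  have h3 : S t f = S t (x n) - S t (x n - f) := by rw [map_sub]; abel
  rw [h3]
  refine (norm_sub_le _ _).trans_lt ?_
  have h4 := hM.norm_apply_le ht1 (x n - f)
  rw [dist_eq_norm, lt_div_iff₀ (by positivity)] at h1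
  linarith

/-- The increments of all orbits tend to zero. -/
theorem tendsto_increment (h : IsC0Semigroup S) {M : ℝ} (hM : IsSemigroupBound S M)
    (hpos : IsPositiveSemigroup S) (hcont : IsEventuallyNormContinuous S) (f : E) {a : ℝ}
    (ha : 0 < a) : Tendsto (fun t => S t (S a f - f)) atTop (𝓝 0) := by
  have hM0 : 0 < M := lt_of_lt_of_le one_pos hM.1
  -- Vectors integrated twice have first differences of order `s` and second differences of order `s
  -- ^ 2`.
  have hsmooth : ∀ b : ℝ, 0 < b → ∀ f : E,
      S a (orbitIntegral S b (orbitIntegral S b f)) - orbitIntegral S b (orbitIntegral S b f) ∈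
        stableSubspace S := by
    intro b hb f
    set g := orbitIntegral S b f with hg
    have hinc : ∀ k : E, ‖S b k - k‖ ≤ 2 * M * ‖k‖ := fun k =>
      (norm_sub_le _ _).trans (by
        have := hM.norm_apply_le hb k
        nlinarith [hM.1, norm_nonneg k])
    have hI : ∀ s : ℝ, 0 < s → ∀ k : E, ‖S s (orbitIntegral S b k) - orbitIntegral S b k‖ ≤
        s * (2 * M ^ 2 * ‖k‖) := by
      intro s hs k
      rw [map_orbitIntegral_sub h hM hb hs]
      refine (norm_orbitIntegral_le hM hs.le _).trans (mul_le_mul_of_nonneg_left ?_ hs.le)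
      have := mul_le_mul_of_nonneg_left (hinc k) hM0.le
      linarith
    refine tendsto_increment_of_smooth h.toIsSemigroup hM hpos hcont
      (L := max (2 * M ^ 2 * ‖g‖) (2 * M ^ 2 * (2 * M ^ 2 * ‖f‖))) (fun s hs => ?_)
      (fun s hs => ?_) ha
    · exact (hI s hs g).trans (mul_le_mul_of_nonneg_left (le_max_left _ _) hs.le)
    · have e : S s (orbitIntegral S b g) - orbitIntegral S b g =
          orbitIntegral S b (S s g - g) := by
        rw [map_orbitIntegral h hM hb.le hs, orbitIntegral_sub h hM]
      rw [e]
      have h3 : ‖S s g - g‖ ≤ s * (2 * M ^ 2 * ‖f‖) := hI s hs f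
      have h4 := mul_le_mul_of_nonneg_left h3 (show 0 ≤ s * (2 * M ^ 2) by positivity)
      refine (hI s hs _).trans ?_
      refine le_trans (by linarith) (mul_le_mul_of_nonneg_left (le_max_right _ _)
        (show 0 ≤ s ^ 2 by positivity))
  -- Double averages approximate `f`, and the stable subspace is closed.
  have hA : Tendsto (fun b : ℝ => b⁻¹ • orbitIntegral S b (b⁻¹ • orbitIntegral S b f))
      (𝓝[>] 0) (𝓝 f) := by
    have h1 := tendsto_orbitIntegral h hM f
    have h2 : Tendsto (fun b : ℝ => b⁻¹ • orbitIntegral S b (b⁻¹ • orbitIntegral S b f - f))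
        (𝓝[>] 0) (𝓝 0) := by
      have h3 := ((h1.sub_const f).norm).const_mul M
      rw [sub_self, norm_zero, mul_zero] at h3
      refine squeeze_zero_norm' ?_ h3
      filter_upwards [self_mem_nhdsWithin] with b hb
      have hb0 : 0 < b := hb
      rw [norm_smul, Real.norm_eq_abs, abs_of_pos (inv_pos.2 hb0), inv_mul_le_iff₀ hb0]
      exact norm_orbitIntegral_le hM hb0.le _
    have h4 := h2.add h1
    rw [zero_add] at h4
    refine h4.congr fun b => ?_
    rw [orbitIntegral_sub h hM, smul_sub, sub_add_cancel]
  have hB := (((S a).continuous.tendsto f).comp hA).sub hA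
  refine (isClosed_stableSubspace hM).mem_of_tendsto hB ?_
  filter_upwards [self_mem_nhdsWithin] with b hb
  have hb0 : 0 < b := hb
  have e : orbitIntegral S b (b⁻¹ • orbitIntegral S b f) =
      orbitIntegral S b (orbitIntegral S b (b⁻¹ • f)) := by
    congr 1
    unfold orbitIntegral
    rw [← intervalIntegral.integral_smul]
    refine intervalIntegral.integral_congr fun t _ => ?_
    simp only [orbit]
    split_ifs <;> simp
  have := (stableSubspace S).smul_mem b⁻¹ (hsmooth b hb0 (b⁻¹ • f))
  rw [smul_sub, ← map_smul, ← e] at this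
  exact this

end Convergence

end BanachLatticeSemigroup

namespace BanachLatticeSemigroup

/-! ### Positive functionals and quasi-interior points. -/

section Functionals

variable {E : Type*} [NormedAddCommGroup E] [NormedSpace ℝ E] [Lattice E] [IsOrderedAddMonoid E]
  [IsOrderedModule ℝ E] [HasSolidNorm E]

theorem norm_posPart_le (a : E) : ‖a⁺‖ ≤ ‖a‖ := by
  refine norm_le_norm_of_abs_le_abs ?_
  rw [abs_of_nonneg (posPart_nonneg a)]
  exact sup_le (le_abs_self a) (abs_nonneg a)

theorem norm_posPart_add_le (a b : E) : ‖(a + b)⁺‖ ≤ ‖a⁺‖ + ‖b⁺‖ :=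
  (norm_le_of_nonneg_of_le (posPart_nonneg _) (sup_le (add_le_add (le_posPart a) (le_posPart b))
    (add_nonneg (posPart_nonneg a) (posPart_nonneg b)))).trans (norm_add_le _ _)

theorem norm_posPart_smul_le {c : ℝ} (hc : 0 ≤ c) (a : E) : ‖(c • a)⁺‖ ≤ c * ‖a⁺‖ := by
  have h := norm_le_of_nonneg_of_le (posPart_nonneg (c • a)) (b := c • a⁺)
    (sup_le (smul_le_smul_of_nonneg_left (le_posPart a) hc) (smul_nonneg hc (posPart_nonneg a)))
  rwa [norm_smul, Real.norm_eq_abs, abs_of_nonneg hc] at h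

theorem posPart_neg_of_nonneg {a : E} (ha : 0 ≤ a) : (-a)⁺ = 0 := by
  rw [posPart_def]; exact sup_eq_right.2 (neg_nonpos.2 ha)

/-- Positive functionals from sublinear functionals that are nonpositive on the negative cone. -/
theorem exists_positive_functional {p : E → ℝ} {C : ℝ}
    (hsmul : ∀ c : ℝ, 0 < c → ∀ x, p (c • x) ≤ c * p x) (hadd : ∀ x y, p (x + y) ≤ p x + p y)
    (hC : ∀ x, p x ≤ C * ‖x‖) (hneg : ∀ g, 0 ≤ g → p (-g) ≤ 0) (v : E) :
    ∃ φ : StrongDual ℝ E, IsPositiveFunctional φ ∧ (∀ x, φ x ≤ p x) ∧ φ v = p v := by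
  have hsmul' : ∀ c : ℝ, 0 < c → ∀ x, p (c • x) = c * p x := by
    intro c hc x
    refine le_antisymm (hsmul c hc x) ?_
    have h := hsmul c⁻¹ (inv_pos.2 hc) (c • x)
    rw [smul_smul, inv_mul_cancel₀ hc.ne', one_smul, le_inv_mul_iff₀ hc] at h
    exact h
  have h0 : p 0 = 0 := by
    have := hsmul' 2 two_pos 0
    rw [smul_zero] at this; linarith
  obtain ⟨f, hfdom, hf⟩ : ∃ f : E →ₗ.[ℝ] ℝ, (∃ h : v ∈ f.domain, f ⟨v, h⟩ = p v) ∧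
      ∀ x : f.domain, f x ≤ p x := by
    by_cases hv : v = 0
    · refine ⟨⊥, ⟨by simp [hv], ?_⟩, ?_⟩
      · have : (⟨v, by simp [hv]⟩ : (⊥ : E →ₗ.[ℝ] ℝ).domain) = 0 := Subtype.ext hv
        rw [this, LinearPMap.map_zero, hv, h0]
      · rintro ⟨x, hx⟩
        have hx0 : x = 0 := (Submodule.mem_bot ℝ).1 hx
        have : (⟨x, hx⟩ : (⊥ : E →ₗ.[ℝ] ℝ).domain) = 0 := Subtype.ext hx0
        rw [this, LinearPMap.map_zero]
        simp [h0]
    · refine ⟨LinearPMap.mkSpanSingleton v (p v) hv,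
        ⟨Submodule.mem_span_singleton_self v, LinearPMap.mkSpanSingleton_apply ℝ ℝ hv _⟩, ?_⟩
      rintro ⟨x, hx⟩
      obtain ⟨c, rfl⟩ := Submodule.mem_span_singleton.1 hx
      rw [LinearPMap.mkSpanSingleton'_apply]
      simp only [RingHom.id_apply, smul_eq_mul]
      rcases lt_trichotomy c 0 with hc | hc | hc
      · have h1 := hsmul' (-c) (neg_pos.2 hc) v
        have h2 := hadd (c • v) (-c • v)
        rw [← add_smul, add_neg_cancel, zero_smul, h0] at h2
        linarith
      · simp [hc, h0]
      · rw [hsmul' c hc]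
  obtain ⟨g, hg, hgp⟩ := exists_extension_of_le_sublinear f p hsmul' hadd hf
  obtain ⟨hvd, hfv⟩ := hfdom
  have hbound : ∀ x, ‖g x‖ ≤ C * ‖x‖ := by
    intro x
    rw [Real.norm_eq_abs, abs_le]
    constructor
    · have := (hgp (-x)).trans (hC (-x))
      rw [map_neg, norm_neg] at this; linarith
    · exact (hgp x).trans (hC x)
  refine ⟨g.mkContinuous C hbound, fun x hx => ?_, hgp, ?_⟩
  · have := (hgp (-x)).trans (hneg x hx)
    rw [map_neg] at this
    change 0 ≤ g x
    linarith
  · change g v = p v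
    rw [← hfv]; exact hg ⟨v, hvd⟩

/-- A positive element is quasi-interior as soon as no nonzero positive functional vanishes on
it. -/
theorem isQuasiInterior_of_forall_functional {u : E} (hu : 0 ≤ u)
    (h : ∀ φ : StrongDual ℝ E, IsPositiveFunctional φ → φ u = 0 → φ = 0) : IsQuasiInterior u := by
  refine ⟨hu, fun v hv => ?_⟩
  -- `p` measures how far a vector is from being dominated by multiples of `u`. As `p u ≤ 0`, a
  -- positive functional below `p` with value `p v` at `v` kills `u`, so it is zero and `p v = 0`.
  set p : E → ℝ := fun g => ⨅ r : NNReal, ‖(g - (r : ℝ) • u)⁺‖ with hp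
  have hbdd : ∀ g : E, BddBelow (range fun r : NNReal => ‖(g - (r : ℝ) • u)⁺‖) :=
    fun g => ⟨0, by rintro _ ⟨r, rfl⟩; exact norm_nonneg _⟩
  have hle : ∀ (g : E) (r : NNReal), p g ≤ ‖(g - (r : ℝ) • u)⁺‖ := fun g r => ciInf_le (hbdd g) r
  obtain ⟨φ, hφ, hφp, hφv⟩ := exists_positive_functional (p := p) (C := 1)
    (by
      intro c hc x
      rw [hp]
      simp only
      rw [Real.mul_iInf_of_nonneg hc.le]
      refine le_ciInf fun r => ?_
      refine (hle (c • x) (c.toNNReal * r)).trans ?_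
      have : c • x - ((c.toNNReal * r : NNReal) : ℝ) • u = c • (x - (r : ℝ) • u) := by
        rw [NNReal.coe_mul, Real.coe_toNNReal c hc.le, smul_sub, mul_smul]
      rw [this]
      exact norm_posPart_smul_le hc.le _)
    (by
      intro x y
      refine le_ciInf_add_ciInf fun r s => ?_
      refine (hle (x + y) (r + s)).trans ?_
      have : x + y - ((r + s : NNReal) : ℝ) • u = (x - (r : ℝ) • u) + (y - (s : ℝ) • u) := by
        push_cast; module
      rw [this]
      exact norm_posPart_add_le _ _)
    (by
      intro x
      have := hle x 0
      rw [NNReal.coe_zero, zero_smul, sub_zero] at this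
      rw [one_mul]; exact this.trans (norm_posPart_le x))
    (by
      intro g hg
      have := hle (-g) 0
      rwa [NNReal.coe_zero, zero_smul, sub_zero, posPart_neg_of_nonneg hg, norm_zero] at this) v
  have hφu : φ u = 0 := by
    refine le_antisymm ?_ (hφ u hu)
    have := (hφp u).trans (hle u 1)
    simpa using this
  have hpv : p v = 0 := by rw [← hφv, h φ hφ hφu]; rfl
  rw [Metric.tendsto_atTop]
  intro ε hε
  obtain ⟨r, hr⟩ := exists_lt_of_ciInf_lt (show p v < ε by rw [hpv]; exact hε)
  obtain ⟨N, hN⟩ := exists_nat_ge (r : ℝ)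
  refine ⟨N, fun n hn => ?_⟩
  rw [dist_comm, dist_eq_norm]
  have h1 : v - v ⊓ (n • u) = (v - n • u)⁺ := by
    rw [posPart_def, sub_inf, sub_self, sup_comm]
  rw [h1]
  refine lt_of_le_of_lt (norm_le_of_nonneg_of_le (posPart_nonneg _) ?_) hr
  refine posPart_mono (sub_le_sub_left ?_ _)
  rw [← Nat.cast_smul_eq_nsmul ℝ n u]
  exact smul_le_smul_of_nonneg_right (hN.trans (by exact_mod_cast hn)) hu

end Functionals

/-! ### Kernels of the generator and its dual as fixed spaces. -/

section FixedSpaces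

variable {E : Type*} [NormedAddCommGroup E] [NormedSpace ℝ E]

/-- The fixed space of a semigroup. -/
def fixedVectors (S : ℝ → E →L[ℝ] E) : Submodule ℝ E where
  carrier := {f | ∀ t : ℝ, 0 < t → S t f = f}
  zero_mem' := by simp
  add_mem' := by
    intro f g hf hg t ht
    rw [map_add, hf t ht, hg t ht]
  smul_mem' := by
    intro c f hf t ht
    rw [map_smul, hf t ht]

/-- The fixed space of the dual semigroup. -/
def fixedFunctionals (S : ℝ → E →L[ℝ] E) : Submodule ℝ (StrongDual ℝ E) where
  carrier := {φ | ∀ t : ℝ, 0 < t → ∀ f, φ (S t f) = φ f}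
  zero_mem' := by simp
  add_mem' := by
    intro φ ψ hφ hψ t ht f
    simp [hφ t ht f, hψ t ht f]
  smul_mem' := by
    intro c φ hφ t ht f
    simp [hφ t ht f]

theorem kerDim_eq_rank {V : Type*} [AddCommGroup V] [Module ℝ V] (A : V →ₗ.[ℝ] V)
    (W : Submodule ℝ V) (h : ∀ v, v ∈ W ↔ (v, (0 : V)) ∈ A.graph) :
    kerDim A = Module.rank ℝ W := by
  have hW : W = (LinearMap.ker A.toFun).map A.domain.subtype := by
    ext v
    rw [h, LinearPMap.mem_graph_iff]
    constructor
    · rintro ⟨y, hy, hy0⟩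
      exact ⟨y, hy0, hy⟩
    · rintro ⟨y, hy0, hy⟩
      exact ⟨y, hy, hy0⟩
  unfold kerDim
  rw [hW]
  exact (Submodule.equivMapOfInjective _ A.domain.injective_subtype _).rank_eq

variable {S : ℝ → E →L[ℝ] E}

theorem mem_graph_generator_iff {f g : E} : (f, g) ∈ (generator S).graph ↔
    Tendsto (fun t : ℝ => t⁻¹ • (S t f - f)) (𝓝[>] 0) (𝓝 g) := by
  rw [LinearPMap.mem_graph_iff]
  constructor
  · rintro ⟨y, hy, hyg⟩
    have := generator_tendsto S y
    rw [hyg, hy] at this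
    exact this
  · intro h
    exact ⟨⟨f, g, h⟩, rfl, tendsto_nhds_unique (generator_tendsto S ⟨f, g, h⟩) h⟩

/-- For the converse, cutting `t` into `n` equal steps bounds `‖S t f - f‖` by `t * M` times the
norm of the difference quotient at `t / n`, which tends to zero. -/
theorem mem_fixedVectors_iff (hS : IsC0Semigroup S) {M : ℝ} (hM : IsSemigroupBound S M) {f : E} :
    f ∈ fixedVectors S ↔ (f, (0 : E)) ∈ (generator S).graph := by
  rw [mem_graph_generator_iff]
  constructor
  · intro h
    refine tendsto_const_nhds.congr' ?_
    filter_upwards [self_mem_nhdsWithin] with t ht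
    rw [h t ht, sub_self, smul_zero]
  · intro h t ht
    have hM0 : 0 < M := lt_of_lt_of_le one_pos hM.1
    have hstep : ∀ s : ℝ, 0 < s → ∀ n : ℕ, ‖(S s ^ n) f - f‖ ≤ n * (M * ‖S s f - f‖) := by
      intro s hs n
      induction n with
      | zero => simp
      | succ n ih =>
        have e : (S s ^ (n + 1)) f - f = (S s ^ n) (S s f - f) + ((S s ^ n) f - f) := by
          rw [pow_succ, map_sub]
          change (S s ^ n) (S s f) - f = _
          abel
        rw [e, Nat.cast_succ]
        refine (norm_add_le _ _).trans ?_
        have h2 := ((S s ^ n).le_opNorm (S s f - f)).trans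
          (mul_le_mul_of_nonneg_right (hM.norm_pow_le hS.toIsSemigroup hs n) (norm_nonneg _))
        linarith
    have hlim : Tendsto (fun n : ℕ => t / ((n : ℝ) + 1)) atTop (𝓝[>] 0) := by
      refine tendsto_nhdsWithin_iff.2 ⟨?_, Eventually.of_forall fun n => ?_⟩
      · exact tendsto_const_div_atTop_nhds_zero_nat t |>.comp (tendsto_add_atTop_nat 1) |>.congr
          fun n => by simp
      · exact div_pos ht (by positivity)
    have h2 := ((h.comp hlim).norm).const_mul (t * M)
    rw [norm_zero, mul_zero] at h2
    have h3 : ∀ n : ℕ, ‖S t f - f‖ ≤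
        t * M * ‖(t / ((n : ℝ) + 1))⁻¹ • (S (t / ((n : ℝ) + 1)) f - f)‖ := by
      intro n
      have hn : (0 : ℝ) < (n : ℝ) + 1 := by positivity
      have hs : 0 < t / ((n : ℝ) + 1) := div_pos ht hn
      have h4 := hstep _ hs (n + 1)
      rw [hS.toIsSemigroup.pow_eq hs, mul_div_cancel₀ _ hn.ne'] at h4
      rw [norm_smul, Real.norm_eq_abs, abs_of_pos (inv_pos.2 hs)]
      refine h4.trans (le_of_eq ?_)
      rw [Nat.cast_succ]
      field_simp
    exact sub_eq_zero.1 (norm_le_zero_iff.1 (ge_of_tendsto' h2 h3))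

variable [CompleteSpace E]

theorem orbitIntegral_mem_graph (hS : IsC0Semigroup S) {M : ℝ} (hM : IsSemigroupBound S M) {a : ℝ}
    (ha : 0 < a) (f : E) :
    (orbitIntegral S a f, S a f - f) ∈ (generator S).graph := by
  rw [mem_graph_generator_iff]
  refine (tendsto_orbitIntegral hS hM (S a f - f)).congr' ?_
  filter_upwards [self_mem_nhdsWithin] with t ht
  rw [map_orbitIntegral_sub hS hM ha ht]

theorem dense_generatorDomain (hS : IsC0Semigroup S) {M : ℝ} (hM : IsSemigroupBound S M) :
    Dense ((generator S).domain : Set E) := by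
  intro f
  refine mem_closure_of_tendsto (tendsto_orbitIntegral hS hM f) ?_
  filter_upwards [self_mem_nhdsWithin] with a ha
  exact (generator S).domain.smul_mem _
    (LinearPMap.mem_domain_of_mem_graph (orbitIntegral_mem_graph hS hM ha f))

/-- For the converse, `S t f - f` is the image of `orbitIntegral S t f` under the generator. -/
theorem mem_fixedFunctionals_iff (hS : IsC0Semigroup S) {M : ℝ} (hM : IsSemigroupBound S M)
    {φ : StrongDual ℝ E} :
    φ ∈ fixedFunctionals S ↔ (φ, (0 : StrongDual ℝ E)) ∈ (dualOperator (generator S)).graph := by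
  rw [graph_dualOperator _ (dense_generatorDomain hS hM)]
  constructor
  · intro h f
    have h1 := (φ.continuous.tendsto _).comp (generator_tendsto S f)
    refine (tendsto_nhds_unique h1 (tendsto_const_nhds.congr' ?_)).symm
    filter_upwards [self_mem_nhdsWithin] with t ht
    simp [h t ht f]
  · intro h t ht f
    obtain ⟨y, -, hy⟩ := (LinearPMap.mem_graph_iff _).1 (orbitIntegral_mem_graph hS hM ht f)
    have h1 : (0 : ℝ) = φ (generator S y) := h y
    rw [hy, map_sub] at h1
    exact sub_eq_zero.1 h1.symm

end FixedSpaces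

end BanachLatticeSemigroup

namespace BanachLatticeSemigroup

/-! ### Fixed functionals, fixed vectors and irreducibility. -/

section Dichotomy

variable {E : Type*} [NormedAddCommGroup E] [NormedSpace ℝ E] [CompleteSpace E] [Lattice E]
  [IsOrderedAddMonoid E] [IsOrderedModule ℝ E] [HasSolidNorm E] {S : ℝ → E →L[ℝ] E}

/-- A vector annihilated by all fixed functionals has an orbit that tends to zero. -/
theorem tendsto_zero_of_forall_fixedFunctional (h : IsC0Semigroup S) {M : ℝ}
    (hM : IsSemigroupBound S M) (hpos : IsPositiveSemigroup S)
    (hcont : IsEventuallyNormContinuous S) {g : E} (hg : ∀ φ ∈ fixedFunctionals S, φ g = 0) :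
    Tendsto (fun t => S t g) atTop (𝓝 0) := by
  change g ∈ stableSubspace S
  by_contra hcon
  obtain ⟨φ, u, hφu, hug⟩ := geometric_hahn_banach_closed_point
    (stableSubspace S).convex (isClosed_stableSubspace hM) hcon
  have hu : 0 < u := by simpa using hφu 0 (stableSubspace S).zero_mem
  have hvan : ∀ w ∈ stableSubspace S, φ w = 0 := by
    intro w hw
    by_contra hne
    have := hφu _ ((stableSubspace S).smul_mem (u / φ w) hw)
    rw [map_smul, smul_eq_mul, div_mul_cancel₀ _ hne] at this
    exact lt_irrefl _ this
  -- All increments `S t f - f` lie in the stable subspace, on which `φ` vanishes.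
  have hfix : φ ∈ fixedFunctionals S := by
    intro t ht f
    have := hvan _ (tendsto_increment h hM hpos hcont f ht)
    rw [map_sub] at this
    exact sub_eq_zero.1 this
  have := hg φ hfix
  linarith

/-- The functional is found below the sublinear limit `p g` of `‖(S (n + 1) g)⁺‖` along a
nonprincipal ultrafilter. As `p` vanishes on increments and their negatives, it is invariant. It is
nonzero because `|φ f| = |φ (S (n + 1) f)| ≤ ‖φ‖ * ‖S (n + 1) |f|‖` gives `p |f| > 0` for a fixed
`φ` with `φ f ≠ 0`. -/
theorem exists_positive_fixedFunctional (h : IsC0Semigroup S) {M : ℝ}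
    (hM : IsSemigroupBound S M) (hpos : IsPositiveSemigroup S)
    (hcont : IsEventuallyNormContinuous S) (hne : fixedFunctionals S ≠ ⊥) :
    ∃ ψ ∈ fixedFunctionals S, IsPositiveFunctional ψ ∧ ψ ≠ 0 := by
  obtain ⟨φ, hφ, hφ0⟩ := Submodule.exists_mem_ne_zero_of_ne_bot hne
  obtain ⟨f, hf⟩ : ∃ f, φ f ≠ 0 := by
    by_contra hcon
    push Not at hcon
    exact hφ0 (ContinuousLinearMap.ext hcon)
  have hn : ∀ n : ℕ, (0 : ℝ) < (n : ℝ) + 1 := fun n => by positivity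
  have hex : ∀ g : E, ∃ r : ℝ, Tendsto (fun n : ℕ => ‖(S ((n : ℝ) + 1) g)⁺‖)
      (hyperfilter ℕ : Filter ℕ) (𝓝 r) := by
    intro g
    obtain ⟨r, -, hr⟩ := (isCompact_Icc (a := (0 : ℝ)) (b := M * ‖g‖)).ultrafilter_le_nhds
      ((hyperfilter ℕ).map fun n : ℕ => ‖(S ((n : ℝ) + 1) g)⁺‖) (by
        rw [le_principal_iff]
        exact Filter.Eventually.of_forall (f := (hyperfilter ℕ : Filter ℕ)) fun n =>
          ⟨norm_nonneg _, (norm_posPart_le _).trans (hM.norm_apply_le (hn n) g)⟩)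
    exact ⟨r, hr⟩
  choose p hp using hex
  obtain ⟨ψ, hψpos, hψp, hψf⟩ := exists_positive_functional (p := p) (C := M)
    (fun c hc x => le_of_tendsto_of_tendsto' (hp (c • x)) ((hp x).const_mul c) fun n => by
      rw [map_smul]; exact norm_posPart_smul_le hc.le _)
    (fun x y => le_of_tendsto_of_tendsto' (hp (x + y)) ((hp x).add (hp y)) fun n => by
      rw [map_add]; exact norm_posPart_add_le _ _)
    (fun x => le_of_tendsto' (hp x) fun n =>
      (norm_posPart_le _).trans (hM.norm_apply_le (hn n) x))
    (fun g hg => le_of_tendsto' (hp (-g)) fun n => by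
      rw [map_neg, posPart_neg_of_nonneg (hpos _ (hn n) g hg), norm_zero]) |f|
  have hatTop : Tendsto (fun n : ℕ => (n : ℝ) + 1) (hyperfilter ℕ : Filter ℕ) atTop :=
    (tendsto_atTop_add_const_right _ _ tendsto_natCast_atTop_atTop).mono_left
      Nat.hyperfilter_le_atTop
  have hpz : ∀ g : E, Tendsto (fun t => S t g) atTop (𝓝 0) → p g = 0 := by
    intro g hg
    refine tendsto_nhds_unique (hp g) ?_
    refine squeeze_zero (fun _ => norm_nonneg _) (fun _ => norm_posPart_le _) ?_
    have := (hg.comp hatTop).norm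
    rwa [norm_zero] at this
  refine ⟨ψ, fun t ht g => ?_, hψpos, fun h0 => ?_⟩
  · have h1 := tendsto_increment h hM hpos hcont g ht
    have h2 := (hψp _).trans (hpz _ h1).le
    have h3 : ψ (-(S t g - g)) ≤ 0 := (hψp _).trans (hpz _ (by
      have := h1.neg
      rw [neg_zero] at this
      exact this.congr fun s => by rw [map_neg])).le
    rw [map_neg] at h3
    rw [map_sub] at h2 h3
    linarith
  · have h1 : p |f| = 0 := by rw [← hψf, h0]; rfl
    have h2 : |φ f| ≤ ‖φ‖ * p |f| := by
      refine ge_of_tendsto' ((hp |f|).const_mul ‖φ‖) fun n => ?_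
      rw [← hφ _ (hn n) f, ← Real.norm_eq_abs]
      refine (φ.le_opNorm _).trans (mul_le_mul_of_nonneg_left ?_ (norm_nonneg _))
      rw [posPart_of_nonneg (hpos _ (hn n) _ (abs_nonneg f)), ← norm_abs_eq_norm (S _ f)]
      exact norm_le_of_nonneg_of_le (abs_nonneg _)
        (IsPositiveOperator.abs_apply_le (hpos _ (hn n)) f)
    rw [h1, mul_zero] at h2
    exact hf (abs_nonpos_iff.1 h2)

theorem isStrictlyPositive_of_fixed (hirr : IsIrreducibleSemigroup S) {ψ : StrongDual ℝ E}
    (hψ : ψ ∈ fixedFunctionals S) (hψpos : IsPositiveFunctional ψ) (hψ0 : ψ ≠ 0) :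
    IsStrictlyPositiveFunctional ψ := by
  intro f hf
  obtain ⟨t, ht, h1⟩ := hirr f hf ψ hψpos hψ0
  rwa [hψ t ht] at h1

theorem isQuasiInterior_of_fixed (hirr : IsIrreducibleSemigroup S) {u : E}
    (hu : u ∈ fixedVectors S) (hu0 : 0 < u) : IsQuasiInterior u := by
  refine isQuasiInterior_of_forall_functional hu0.le fun φ hφ hφu => ?_
  by_contra hne
  obtain ⟨t, ht, h1⟩ := hirr u hu0 φ hφ hne
  rw [hu t ht, hφu] at h1
  exact lt_irrefl _ h1

/-- Positivity gives `|f| ≤ S t |f|`, and `ψ` agrees on the two sides; strict positivity leaves no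
room for a difference. -/
theorem abs_mem_fixedVectors (hpos : IsPositiveSemigroup S) {ψ : StrongDual ℝ E}
    (hψ : ψ ∈ fixedFunctionals S) (hψpos : IsStrictlyPositiveFunctional ψ) {f : E}
    (hf : f ∈ fixedVectors S) : |f| ∈ fixedVectors S := by
  intro t ht
  have h1 : |f| ≤ S t |f| := by
    have := IsPositiveOperator.abs_apply_le (hpos t ht) f
    rwa [hf t ht] at this
  by_contra hne
  have h2 := hψpos (S t |f| - |f|) (sub_pos.2 (lt_of_le_of_ne h1 (Ne.symm hne)))
  rw [map_sub, hψ t ht, sub_self] at h2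
  exact lt_irrefl _ h2

/-- The fixed space of an irreducible semigroup with a strictly positive fixed functional is
at most one-dimensional. -/
theorem eq_smul_of_mem_fixedVectors (hpos : IsPositiveSemigroup S)
    (hirr : IsIrreducibleSemigroup S) {ψ : StrongDual ℝ E}
    (hψ : ψ ∈ fixedFunctionals S) (hψpos : IsStrictlyPositiveFunctional ψ) {u f : E}
    (hu : u ∈ fixedVectors S) (hψu : ψ u = 1) (hf : f ∈ fixedVectors S) : f = ψ f • u := by
  set g := f - ψ f • u with hg
  have hgf : g ∈ fixedVectors S := sub_mem hf ((fixedVectors S).smul_mem _ hu)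
  have hψg : ψ g = 0 := by rw [hg, map_sub, map_smul, hψu, smul_eq_mul, mul_one, sub_self]
  have habs := abs_mem_fixedVectors hpos hψ hψpos hgf
  have hp : g⁺ ∈ fixedVectors S := by
    have : g⁺ = (2⁻¹ : ℝ) • (|g| + g) := by
      have h1 := posPart_add_negPart g
      have h2 := posPart_sub_negPart g
      rw [← h1]
      nth_rewrite 4 [← h2]
      module
    rw [this]
    exact (fixedVectors S).smul_mem _ (add_mem habs hgf)
  -- A nonzero fixed `g⁺` would be quasi-interior and disjoint from `g⁻`, forcing `g⁻ = 0` and hence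
  -- `ψ g > 0`, whereas `ψ g = 0`.
  have hfinal : g⁺ = 0 := by
    by_contra hne
    have hp0 : 0 < g⁺ := lt_of_le_of_ne (posPart_nonneg g) (Ne.symm hne)
    have hq := (isQuasiInterior_of_fixed hirr hp hp0).2 g⁻ (negPart_nonneg g)
    have hz : ∀ n : ℕ, g⁻ ⊓ (n • g⁺) = 0 := by
      intro n
      have h0 : g⁻ ⊓ g⁺ = 0 := by rw [inf_comm]; exact posPart_inf_negPart_eq_zero g
      induction n with
      | zero => rw [zero_smul]; exact inf_eq_right.2 (negPart_nonneg g)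
      | succ n ih =>
        refine le_antisymm ?_ (le_inf (negPart_nonneg g) (nsmul_nonneg (posPart_nonneg g) _))
        refine (le_inf inf_le_left ?_).trans ih.le
        have h2 : g⁻ ⊓ ((n + 1) • g⁺) - n • g⁺ ≤ g⁻ ⊓ g⁺ := by
          refine le_inf ?_ ?_
          · exact (sub_le_self _ (nsmul_nonneg (posPart_nonneg g) _)).trans inf_le_left
          · rw [sub_le_iff_le_add, ← succ_nsmul']
            exact inf_le_right
        rw [h0] at h2
        exact sub_nonpos.1 h2
    simp only [hz] at hq
    have hneg : g⁻ = 0 := tendsto_nhds_unique hq tendsto_const_nhds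
    have h3 := hψpos _ hp0
    have h4 := posPart_sub_negPart g
    rw [hneg, sub_zero] at h4
    rw [h4, hψg] at h3
    exact lt_irrefl _ h3
  have hneg0 : g = 0 := by
    by_contra hne
    have h4 := posPart_sub_negPart g
    rw [hfinal, zero_sub] at h4
    have h5 : 0 < g⁻ := lt_of_le_of_ne (negPart_nonneg g) (by
      intro h0
      rw [← h0, neg_zero] at h4
      exact hne h4.symm)
    have h6 := hψpos _ h5
    rw [← neg_eq_iff_eq_neg.2 h4.symm, map_neg, hψg, neg_zero] at h6
    exact lt_irrefl _ h6
  exact sub_eq_zero.1 hneg0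

/-- In the presence of a nonzero fixed functional, a nonzero fixed space contains a positive
vector `u` on which a strictly positive fixed functional is normalized. -/
theorem exists_normalized_pair (h : IsC0Semigroup S) {M : ℝ}
    (hM : IsSemigroupBound S M) (hpos : IsPositiveSemigroup S) (hirr : IsIrreducibleSemigroup S)
    (hcont : IsEventuallyNormContinuous S) (hne : fixedFunctionals S ≠ ⊥)
    (hne' : fixedVectors S ≠ ⊥) :
    ∃ u ∈ fixedVectors S, ∃ ψ ∈ fixedFunctionals S, 0 < u ∧ IsStrictlyPositiveFunctional ψ ∧
      ψ u = 1 := by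
  obtain ⟨ψ, hψ, hψpos, hψ0⟩ := exists_positive_fixedFunctional h hM hpos hcont hne
  have hψs := isStrictlyPositive_of_fixed hirr hψ hψpos hψ0
  obtain ⟨f, hf, hf0⟩ := Submodule.exists_mem_ne_zero_of_ne_bot hne'
  have hu := abs_mem_fixedVectors hpos hψ hψs hf
  have hu0 : 0 < |f| := lt_of_le_of_ne (abs_nonneg f) (by
    intro h0
    apply hf0
    have := norm_abs_eq_norm f
    rw [← h0, norm_zero] at this
    exact norm_eq_zero.1 this.symm)
  have hpu := hψs _ hu0
  refine ⟨|f|, hu, (ψ |f|)⁻¹ • ψ, (fixedFunctionals S).smul_mem _ hψ, hu0, fun g hg => ?_, ?_⟩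
  · exact mul_pos (inv_pos.2 hpu) (hψs g hg)
  · exact inv_mul_cancel₀ hpu.ne'

end Dichotomy

theorem limit_mem_fixedVectors {E : Type*} [NormedAddCommGroup E] [NormedSpace ℝ E]
    {S : ℝ → E →L[ℝ] E} (h : IsSemigroup S) {f g : E}
    (hg : Tendsto (fun t => S t f) atTop (𝓝 g)) : g ∈ fixedVectors S := by
  intro t ht
  have h1 := ((S t).continuous.tendsto g).comp hg
  have h2 := hg.comp (tendsto_atTop_add_const_left atTop t tendsto_id)
  refine tendsto_nhds_unique (h1.congr' ?_) h2
  filter_upwards [eventually_gt_atTop 0] with s hs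
  exact (h.apply_add ht hs f).symm

theorem fixedFunctional_apply_limit {E : Type*} [NormedAddCommGroup E] [NormedSpace ℝ E]
    {S : ℝ → E →L[ℝ] E} {f g : E} (hg : Tendsto (fun t => S t f) atTop (𝓝 g))
    {φ : StrongDual ℝ E} (hφ : φ ∈ fixedFunctionals S) : φ g = φ f := by
  refine tendsto_nhds_unique ((φ.continuous.tendsto g).comp hg) (tendsto_const_nhds.congr' ?_)
  filter_upwards [eventually_gt_atTop 0] with s hs
  exact (hφ s hs f).symm

theorem rank_submodule_eq_one_iff_mem {V : Type*} [AddCommGroup V] [Module ℝ V]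
    (W : Submodule ℝ V) :
    Module.rank ℝ W = 1 ↔ ∃ v ∈ W, v ≠ 0 ∧ ∀ w ∈ W, ∃ c : ℝ, c • v = w := by
  rw [rank_submodule_eq_one_iff]
  simp only [SetLike.le_def, Submodule.mem_span_singleton]

theorem rank_submodule_le_one_of_mem {V : Type*} [AddCommGroup V] [Module ℝ V]
    {W : Submodule ℝ V} {v : V} (hv : v ∈ W) (h : ∀ w ∈ W, ∃ c : ℝ, c • v = w) :
    Module.rank ℝ W ≤ 1 :=
  (rank_submodule_le_one_iff W).2 ⟨v, hv, fun w hw => Submodule.mem_span_singleton.2 (h w hw)⟩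

theorem cardinal_eq_zero_or_eq_one_or_two_le (c : Cardinal) : c = 0 ∨ c = 1 ∨ 2 ≤ c := by
  rcases lt_or_ge c 2 with hc | hc
  · obtain ⟨n, rfl⟩ := Cardinal.lt_aleph0.1 (hc.trans (by exact_mod_cast Cardinal.natCast_lt_aleph0 (n := 2)))
    have : n < 2 := by exact_mod_cast hc
    interval_cases n <;> simp
  · exact Or.inr (Or.inr hc)

end BanachLatticeSemigroup

/-! ### The four situations. -/

theorem mainTheorem2 {E : Type*} [NormedAddCommGroup E] [NormedSpace ℝ E] [CompleteSpace E]
    [Lattice E] [IsOrderedAddMonoid E] [IsOrderedModule ℝ E] [HasSolidNorm E]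
    (S : ℝ → E →L[ℝ] E) (hC0 : IsC0Semigroup S) (hpos : IsPositiveSemigroup S)
    (hbdd : IsBoundedSemigroup S) (hirr : IsIrreducibleSemigroup S)
    (hcont : IsEventuallyNormContinuous S) :
    -- precisely one of the four situations occurs
    (∃! i : Fin 4,
      ![kerDim (dualOperator (generator S)) = 0,
        kerDim (dualOperator (generator S)) = 1 ∧ kerDim (generator S) = 1,
        kerDim (dualOperator (generator S)) = 1 ∧ kerDim (generator S) = 0,
        2 ≤ kerDim (dualOperator (generator S))] i) ∧
    -- and the asymptotic behaviour in each of them is as follows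
    (kerDim (dualOperator (generator S)) = 0 →
      ∀ f : E, Tendsto (fun t => S t f) atTop (𝓝 0)) ∧
    (kerDim (dualOperator (generator S)) = 1 ∧ kerDim (generator S) = 1 →
      ∃ (u : E) (φ : StrongDual ℝ E), IsQuasiInterior u ∧ IsStrictlyPositiveFunctional φ ∧
        ∀ f : E, Tendsto (fun t => S t f) atTop (𝓝 (φ f • u))) ∧
    (kerDim (dualOperator (generator S)) = 1 ∧ kerDim (generator S) = 0 →
      ¬ ConvergesStrongly S) ∧
    (2 ≤ kerDim (dualOperator (generator S)) → ¬ ConvergesStrongly S) := by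
  obtain ⟨M, hM⟩ := exists_isSemigroupBound hbdd
  have hS := hC0.toIsSemigroup
  rw [kerDim_eq_rank (generator S) (fixedVectors S) fun f => mem_fixedVectors_iff hC0 hM,
    kerDim_eq_rank (dualOperator (generator S)) (fixedFunctionals S)
      fun φ => mem_fixedFunctionals_iff hC0 hM]
  -- This makes the four situations exhaustive.
  have hdich : Module.rank ℝ (fixedFunctionals S) ≠ 0 →
      Module.rank ℝ (fixedVectors S) = 0 ∨ Module.rank ℝ (fixedVectors S) = 1 := by
    intro h
    by_cases hF : fixedVectors S = ⊥
    · exact Or.inl (Submodule.rank_eq_zero.2 hF)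
    · obtain ⟨u, hu, ψ, hψ, hu0, hψs, hψu⟩ :=
        exists_normalized_pair hC0 hM hpos hirr hcont (fun h0 => h (Submodule.rank_eq_zero.2 h0)) hF
      refine Or.inr ((rank_submodule_eq_one_iff_mem _).2 ⟨u, hu, hu0.ne', fun f hf =>
        ⟨ψ f, (eq_smul_of_mem_fixedVectors hpos hirr hψ hψs hu hψu hf).symm⟩⟩)
  -- Limits of orbits are fixed, hence zero here, and a fixed functional takes the same value at `f`
  -- as at the limit of its orbit.
  have hnot : Module.rank ℝ (fixedFunctionals S) ≠ 0 → Module.rank ℝ (fixedVectors S) = 0 →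
      ¬ ConvergesStrongly S := by
    intro h h0 hconv
    obtain ⟨φ, hφ, hφ0⟩ := Submodule.exists_mem_ne_zero_of_ne_bot
      (fun h0 => h (Submodule.rank_eq_zero.2 h0))
    refine hφ0 (ContinuousLinearMap.ext fun f => ?_)
    obtain ⟨g, hg⟩ := hconv f
    have hgF := limit_mem_fixedVectors hS hg
    rw [Submodule.rank_eq_zero.1 h0, Submodule.mem_bot] at hgF
    rw [← fixedFunctional_apply_limit hg hφ, hgF, map_zero]
    rfl
  have h10 : (1 : Cardinal) ≠ 0 := one_ne_zero
  refine ⟨?_, ?_, ?_, ?_, ?_⟩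
  · rcases cardinal_eq_zero_or_eq_one_or_two_le (Module.rank ℝ (fixedFunctionals S)) with h | h | h
    · refine ⟨0, h, fun i hi => ?_⟩
      fin_cases i
      · rfl
      · exact absurd (h.symm.trans hi.1) h10.symm
      · exact absurd (h.symm.trans hi.1) h10.symm
      · exact absurd (h ▸ hi : (2 : Cardinal) ≤ 0) (by simp)
    · have h2 : ¬ (2 : Cardinal) ≤ 1 := by norm_num
      rcases hdich (h ▸ h10) with h' | h'
      · refine ⟨2, ⟨h, h'⟩, fun i hi => ?_⟩
        fin_cases i
        · exact absurd (h.symm.trans hi) h10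
        · exact absurd (h'.symm.trans hi.2) h10.symm
        · rfl
        · exact absurd (h ▸ hi : (2 : Cardinal) ≤ 1) h2
      · refine ⟨1, ⟨h, h'⟩, fun i hi => ?_⟩
        fin_cases i
        · exact absurd (h.symm.trans hi) h10
        · rfl
        · exact absurd (h'.symm.trans hi.2) h10
        · exact absurd (h ▸ hi : (2 : Cardinal) ≤ 1) h2
    · have h0 : ∀ c : Cardinal, c ≤ 1 → Module.rank ℝ (fixedFunctionals S) ≠ c := by
        rintro c hc rfl
        exact absurd (h.trans hc) (by norm_num)
      refine ⟨3, h, fun i hi => ?_⟩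
      fin_cases i
      · exact absurd hi (h0 0 zero_le_one)
      · exact absurd hi.1 (h0 1 le_rfl)
      · exact absurd hi.1 (h0 1 le_rfl)
      · rfl
  · intro h f
    refine tendsto_zero_of_forall_fixedFunctional hC0 hM hpos hcont fun φ hφ => ?_
    rw [Submodule.rank_eq_zero.1 h, Submodule.mem_bot] at hφ
    rw [hφ]; rfl
  · rintro ⟨h, h'⟩
    obtain ⟨u, hu, ψ, hψ, hu0, hψs, hψu⟩ := exists_normalized_pair hC0 hM hpos hirr hcont
      (fun h0 => (h ▸ h10) (Submodule.rank_eq_zero.2 h0))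
      (fun h0 => (h' ▸ h10) (Submodule.rank_eq_zero.2 h0))
    refine ⟨u, ψ, isQuasiInterior_of_fixed hirr hu hu0, hψs, fun f => ?_⟩
    obtain ⟨φ₀, hφ₀, -, hspan⟩ := (rank_submodule_eq_one_iff_mem (fixedFunctionals S)).1 h
    -- Every fixed functional is a multiple of `ψ`, which kills `f - ψ f • u`.
    have hz : Tendsto (fun t => S t (f - ψ f • u)) atTop (𝓝 0) := by
      refine tendsto_zero_of_forall_fixedFunctional hC0 hM hpos hcont fun φ hφ => ?_
      obtain ⟨a, ha⟩ := hspan φ hφ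
      obtain ⟨b, hb⟩ := hspan ψ hψ
      have hψz : ψ (f - ψ f • u) = 0 := by
        rw [map_sub, map_smul, hψu, smul_eq_mul, mul_one, sub_self]
      have hb0 : b ≠ 0 := by
        rintro rfl
        rw [zero_smul] at hb
        rw [← hb] at hψu
        exact zero_ne_one hψu
      have hφ₀z : φ₀ (f - ψ f • u) = 0 := by
        rw [← hb] at hψz
        have : b * φ₀ (f - (b • φ₀) f • u) = 0 := hψz
        rw [hb] at this
        exact (mul_eq_zero.1 this).resolve_left hb0
      rw [← ha]
      change a * φ₀ _ = 0
      rw [hφ₀z, mul_zero]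
    have h1 := hz.add_const (ψ f • u)
    rw [zero_add] at h1
    refine h1.congr' ?_
    filter_upwards [eventually_gt_atTop 0] with t ht
    rw [map_sub, map_smul, hu t ht, sub_add_cancel]
  · rintro ⟨h, h'⟩
    exact hnot (h ▸ h10) h'
  · intro h hconv
    have h0 : Module.rank ℝ (fixedFunctionals S) ≠ 0 := by
      intro h0
      rw [h0] at h
      exact absurd h (by simp)
    rcases hdich h0 with h' | h'
    · exact hnot h0 h' hconv
    · obtain ⟨u, hu, ψ, hψ, hu0, hψs, hψu⟩ := exists_normalized_pair hC0 hM hpos hirr hcont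
        (fun h1 => h0 (Submodule.rank_eq_zero.2 h1))
        (fun h0 => (h' ▸ h10) (Submodule.rank_eq_zero.2 h0))
      -- The limit of `S t f` is `ψ f • u`, so a fixed `φ` satisfies `φ f = ψ f * φ u` and is a
      -- multiple of `ψ`.
      have hle : Module.rank ℝ (fixedFunctionals S) ≤ 1 := by
        refine rank_submodule_le_one_of_mem hψ fun φ hφ => ?_
        refine ⟨φ u, ContinuousLinearMap.ext fun f => ?_⟩
        obtain ⟨g, hg⟩ := hconv f
        have hgF := eq_smul_of_mem_fixedVectors hpos hirr hψ hψs hu hψu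
          (limit_mem_fixedVectors hS hg)
        rw [← fixedFunctional_apply_limit hg hφ, hgF, fixedFunctional_apply_limit hg hψ, map_smul]
        exact mul_comm _ _
      exact absurd (h.trans hle) (by norm_num)
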